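/- **Model (TSO).** There are $n$ processes. Each process $i$ has a FIFO store buffer and a local dispatcher $d_i$; processes and dispatchers are the agents. A write by $i$ appends a pair (variable, value) to $i$'s buffer. A read of $x$ by $i$ returns the latest value for $x$ in $i$'s buffer if there is one, and the value of $x$ in memory otherwise. A fence $\mathtt F$ by $i$ is enabled only if $i$'s buffer is empty; $\mathtt{RMW}[x,v_{\exp},v_{\rm new}]$ is enabled only if $i$'s buffer is empty and $x=v_{\exp}$ in memory, and it sets $x$ to $v_{\rm new}$ in memory. A propagate action of $d_i$ is enabled when $i$'s buffer is nonempty; it moves the oldest pair to memory. Processes may also perform internal and $\mathtt{return}$ actions. The local state of a process is the list of its invocations and of its non-null actions so far, with the values read. A run is a sequence of global states (memory, buffers, local states), starting with empty buffers and empty local states. In the round from time $t$ to time $t+1$ every agent performs an enabled action or the null action, no two of these actions conflict, and the environment may invoke an operation at processes with no pending operation. Two actions conflict if both access the same variable in memory (as an $\mathtt{RMW}$, a propagation or a read from memory), they are not both reads from memory, and they are not a propagation by $d_i$ together with a read from memory by $i$. A protocol assigns to each process and local state a nonempty set of permitted actions; in a run of an implementation, all non-null actions of processes are permitted by its protocol.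 Each value is written to the register at most once in a run. A run is fair if every nonempty buffer eventually has a propagation and every process that from some time on always has an enabled permitted non-null action eventually moves. **Operations.** An operation $X$ of process $i$ invoked in the round from time $t$ to time $t+1$ starts at time $t_{X.s}=t$; if its return action is performed in the round from time $t'-1$ to time $t'$, it ends at time $t_{X.e}=t'$. Write $X<_r Y$ if $t_{X.e}<t_{Y.s}$ in $r$; $X$ runs in isolation in $r$ if every other operation $Y$ of $r$ satisfies $X<_rY$ or $Y<_rX$. $X$ runs solo if at times $t_{X.s}\le t<t_{X.e}$ no agent other than $i$ and $d_i$ moves. $X$ contains an action if $i$ performs it after the invocation of $X$ and no later than its return. An operation on value $a$ is a $\mathsf{Read}$ that returns $a$ or a $\mathsf{Write}$ of $a$. A register implementation is linearizable if every fair run of it is linearizable with respect to the register with a fixed default value. It is obstruction-free if, whenever from some time on only one process $i$ and its dispatcher move, both being scheduled fairly, a pending operation of $i$ completes. **Theorem.** Let $\mathcal I$ be an obstruction-free linearizable implementation in TSO of a multi-writer multi-reader register, and let $a\ne b$ be register values. Let $r$ be a run of $\mathcal I$ in which an operation $X$ on value $a$ of process $i$ runs solo and in isolation and completes, such that no $\mathsf{Write}(b)$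 is invoked in $r$ before the end of $X$. Suppose that $X$ contains neither $\mathtt F$ nor $\mathtt{RMW}$ actions in $r$. Then for every process $j\neq i$ there is a fair run $\tilde r$ of $\mathcal I$ such that * process $i$ has the same local state in $\tilde r$ as in $r$ at every time up to the end of $X$; in particular $X$ occurs in $\tilde r$, with the same start, end and response; * in $\tilde r$, process $j$ performs a $\mathsf{Write}(b)$ that completes, with $X<_{\tilde r}\mathsf{Write}(b)$, and this $\mathsf{Write}(b)$ contains an $\mathtt F$ or an $\mathtt{RMW}$ action in $\tilde r$. -/

import Mathlib

namespace TSO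

/-! ### Register operations, actions, recorded events

`X` is the set of shared variables, `D` the set of values that variables hold, `A` the set of
values of the implemented register, `L` a set of labels of internal actions.
Processes are the elements of `Fin n`; process `i` has a local dispatcher `d_i`. -/

/-- The operations of a register. -/
inductive Op (A : Type*) where
  | read : Op A
  | write (v : A) : Op A

/-- The responses of register operations. -/
inductive Resp (A : Type*) where
  | value (v : A) : Resp A
  | ack : Resp A

/-- A response of the right kind: a value for a read, an acknowledgment for a write. -/
def Resp.Fits {A : Type*} : Resp A → Op A → Prop
  | .value _, .read => True
  | .ack, .write _ => True
  | _, _ => False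

/-- The actions of a process. `null` is the null action, `ret p` returns response `p` to the
pending operation, `internal l` only changes the local state. -/
inductive Act (X D A L : Type*) where
  | null : Act X D A L
  | read (x : X) : Act X D A L
  | write (x : X) (v : D) : Act X D A L
  | fence : Act X D A L
  | rmw (x : X) (exp new : D) : Act X D A L
  | internal (l : L) : Act X D A L
  | ret (p : Resp A) : Act X D A L

/-- The action is a fence or a read-modify-write. -/
def Act.IsSync {X D A L : Type*} : Act X D A L → Prop
  | .fence => True
  | .rmw _ _ _ => True
  | _ => False

/-- The records that make up a local state. A read is recorded with the value returned, but not
with its source (buffer or memory). -/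
inductive Event (X D A L : Type*) where
  | read (x : X) (v : D) : Event X D A L
  | write (x : X) (v : D) : Event X D A L
  | fence : Event X D A L
  | rmw (x : X) (exp new : D) : Event X D A L
  | internal (l : L) : Event X D A L
  | ret (p : Resp A) : Event X D A L
  | invoke (o : Op A) : Event X D A L

/-- A local state is the list of all records so far, oldest first. -/
abbrev Local (X D A L : Type*) := List (Event X D A L)

/-- Effect of one record on the operation currently pending. -/
def Event.updPending {X D A L : Type*} (q : Option (Op A)) : Event X D A L → Option (Op A)
  | .invoke o => some o
  | .ret _ => none
  | _ => q

/-- The operation that is pending at a process with the given local state, if any. -/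
def pending {X D A L : Type*} (l : Local X D A L) : Option (Op A) :=
  l.foldl Event.updPending none

/-! ### TSO states, joint actions and their effect -/

/-- Main memory, and for each process a store buffer (oldest item first). -/
structure MemState (n : ℕ) (X D : Type*) where
  mem : X → D
  buf : Fin n → List (X × D)

/-- A global state: a TSO state and a local state for every process. -/
structure Global (n : ℕ) (X D A L : Type*) where
  tso : MemState n X D
  loc : Fin n → Local X D A L

/-- A joint action: an action for each process, for each dispatcher whether it propagates
(`true`) or performs the null action (`false`), and at most one invocation per process by the
environment. -/
structure Joint (n : ℕ) (X D A L : Type*) where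
  proc : Fin n → Act X D A L
  disp : Fin n → Bool
  env : Fin n → Option (Op A)

/-- The value of the latest item for `x` in a buffer, if there is one. -/
def bufLookup {X D : Type*} [DecidableEq X] (β : List (X × D)) (x : X) : Option D :=
  ((β.filter fun p => p.1 = x).getLast?).map Prod.snd

/-- The value returned to `i` by a read of `x`: from `i`'s buffer if it holds an item for `x`,
and otherwise from memory. -/
def readVal {n : ℕ} {X D : Type*} [DecidableEq X] (σ : MemState n X D) (i : Fin n) (x : X) : D :=
  (bufLookup (σ.buf i) x).getD (σ.mem x)

/-- Precondition of an action of process `i` in a global state. -/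
def ActEnabled {n : ℕ} {X D A L : Type*} (g : Global n X D A L) (i : Fin n) :
    Act X D A L → Prop
  | .fence => g.tso.buf i = []
  | .rmw x exp _ => g.tso.buf i = [] ∧ g.tso.mem x = exp
  | .ret p => ∃ o, pending (g.loc i) = some o ∧ p.Fits o
  | _ => True

/-- Effect of an action of process `i` on the TSO state. -/
def actEffect {n : ℕ} {X D A L : Type*} [DecidableEq X] (σ : MemState n X D) (i : Fin n) :
    Act X D A L → MemState n X D
  | .write x v => { σ with buf := Function.update σ.buf i (σ.buf i ++ [(x, v)]) }
  | .rmw x _ new => { σ with mem := Function.update σ.mem x new }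
  | _ => σ

/-- Effect of a propagate action of the dispatcher of `i` on the TSO state. -/
def propEffect {n : ℕ} {X D : Type*} [DecidableEq X] (σ : MemState n X D) (i : Fin n) :
    MemState n X D :=
  match σ.buf i with
  | [] => σ
  | (x, v) :: β => ⟨Function.update σ.mem x v, Function.update σ.buf i β⟩

/-- The record of an action of process `i` performed in the TSO state `σ`. -/
def record {n : ℕ} {X D A L : Type*} [DecidableEq X] (σ : MemState n X D) (i : Fin n) :
    Act X D A L → Local X D A L
  | .null => []
  | .read x => [.read x (readVal σ i x)]
  | .write x v => [.write x v]
  | .fence => [.fence]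
  | .rmw x exp new => [.rmw x exp new]
  | .internal l => [.internal l]
  | .ret p => [.ret p]

/-- The agents: processes and local dispatchers. -/
inductive Agent (n : ℕ) where
  | proc (i : Fin n) : Agent n
  | disp (i : Fin n) : Agent n

/-- In `σ` under `a`, the agent reads `x` from memory. -/
def ReadsMem {n : ℕ} {X D A L : Type*} [DecidableEq X] (σ : MemState n X D)
    (a : Joint n X D A L) : Agent n → X → Prop
  | .proc i, x => a.proc i = .read x ∧ bufLookup (σ.buf i) x = none
  | .disp _, _ => False

/-- In `σ` under `a`, the agent propagates an item for `x`. -/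
def Propagates {n : ℕ} {X D A L : Type*} (σ : MemState n X D)
    (a : Joint n X D A L) : Agent n → X → Prop
  | .proc _, _ => False
  | .disp i, x => a.disp i = true ∧ ∃ v β, σ.buf i = (x, v) :: β

/-- Under `a`, the agent performs a read-modify-write on `x`. -/
def Rmws {n : ℕ} {X D A L : Type*} (a : Joint n X D A L) : Agent n → X → Prop
  | .proc i, x => ∃ exp new, a.proc i = .rmw x exp new
  | .disp _, _ => False

/-- In `σ` under `a`, the agent accesses the variable `x` in memory. -/
def Accesses {n : ℕ} {X D A L : Type*} [DecidableEq X] (σ : MemState n X D)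
    (a : Joint n X D A L) (b : Agent n) (x : X) : Prop :=
  ReadsMem σ a b x ∨ Propagates σ a b x ∨ Rmws a b x

/-- The agents `b` and `c` access the same variable, not both by reading it from memory, and it is
not the case that one of them is a dispatcher `d_i` that propagates and the other is process `i`
that reads from memory. -/
def Conflict {n : ℕ} {X D A L : Type*} [DecidableEq X] (σ : MemState n X D)
    (a : Joint n X D A L) (b c : Agent n) : Prop :=
  ∃ x, Accesses σ a b x ∧ Accesses σ a c x ∧
    ¬ (ReadsMem σ a b x ∧ ReadsMem σ a c x) ∧
    ¬ (∃ i, b = .disp i ∧ c = .proc i ∧ Propagates σ a b x ∧ ReadsMem σ a c x) ∧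
    ¬ (∃ i, c = .disp i ∧ b = .proc i ∧ Propagates σ a c x ∧ ReadsMem σ a b x)

/-- A joint action is enabled in `g` if each of its components is, and no two of them conflict.
The environment, which acts last in a round, invokes an operation at `i` only if no operation is
then pending at `i`. -/
structure JointEnabled {n : ℕ} {X D A L : Type*} [DecidableEq X] (g : Global n X D A L)
    (a : Joint n X D A L) : Prop where
  proc : ∀ i, ActEnabled g i (a.proc i)
  disp : ∀ i, a.disp i = true → g.tso.buf i ≠ []
  env : ∀ i, a.env i ≠ none → pending (g.loc i ++ record g.tso i (a.proc i)) = none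
  no_conflict : ∀ b c, b ≠ c → ¬ Conflict g.tso a b c

/-- The global state that results from a joint action: the actions of the processes, in order,
then those of the dispatchers, in order, are applied to the TSO state; and the
actions and invocations are recorded in the local states. -/
def next {n : ℕ} {X D A L : Type*} [DecidableEq X] (g : Global n X D A L)
    (a : Joint n X D A L) : Global n X D A L where
  tso := (List.finRange n).foldl (fun σ i => if a.disp i then propEffect σ i else σ)
    ((List.finRange n).foldl (fun σ i => actEffect σ i (a.proc i)) g.tso)
  loc := fun i => g.loc i ++ record g.tso i (a.proc i) ++
    ((a.env i).map Event.invoke).toList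

/-! ### Implementations and their runs -/

/-- An implementation: a nondeterministic protocol for each process (the set of actions that it
may perform in each local state), and the permitted initial contents of the memory. -/
structure Implementation (n : ℕ) (X D A L : Type*) where
  protocol : Fin n → Local X D A L → Set (Act X D A L)
  protocol_nonempty : ∀ i l, (protocol i l).Nonempty
  initMem : Set (X → D)

/-- A sequence of global states, with the joint action `act t` taking `state t` to
`state (t + 1)`. -/
structure Run (n : ℕ) (X D A L : Type*) where
  state : ℕ → Global n X D A L
  act : ℕ → Joint n X D A L

/-- `r` is an execution of `I`, with no assumption on the fairness of scheduling. As a standing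
assumption on the environment, each value is written to the register at most once. -/
structure IsExecution {n : ℕ} {X D A L : Type*} [DecidableEq X] (I : Implementation n X D A L)
    (r : Run n X D A L) : Prop where
  mem_zero : (r.state 0).tso.mem ∈ I.initMem
  buf_zero : ∀ i, (r.state 0).tso.buf i = []
  loc_zero : ∀ i, (r.state 0).loc i = []
  enabled : ∀ t, JointEnabled (r.state t) (r.act t)
  step : ∀ t, r.state (t + 1) = next (r.state t) (r.act t)
  follows : ∀ t i, (r.act t).proc i ≠ .null →
    (r.act t).proc i ∈ I.protocol i ((r.state t).loc i)
  write_once : ∀ v t t' i i', (r.act t).env i = some (.write v) →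
    (r.act t').env i' = some (.write v) → t = t' ∧ i = i'

/-- The protocol of `i` allows a non-null action that is enabled in `g`. -/
def CanMove {n : ℕ} {X D A L : Type*} (I : Implementation n X D A L) (g : Global n X D A L)
    (i : Fin n) : Prop :=
  ∃ a ∈ I.protocol i (g.loc i), a ≠ .null ∧ ActEnabled g i a

/-- Fair scheduling of process `i`: if from some time on it can always move, then it does. -/
def FairProc {n : ℕ} {X D A L : Type*} (I : Implementation n X D A L) (r : Run n X D A L)
    (i : Fin n) : Prop :=
  ∀ T, (∀ t, T ≤ t → CanMove I (r.state t) i) → ∃ t, T ≤ t ∧ (r.act t).proc i ≠ .null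

/-- Fair scheduling of the dispatcher of `i`: an enabled propagate action is eventually
performed. -/
def FairDisp {n : ℕ} {X D A L : Type*} (r : Run n X D A L) (i : Fin n) : Prop :=
  ∀ T, (r.state T).tso.buf i ≠ [] → ∃ t, T ≤ t ∧ (r.act t).disp i = true

/-- All processes and all dispatchers are scheduled fairly. -/
def IsFair {n : ℕ} {X D A L : Type*} (I : Implementation n X D A L) (r : Run n X D A L) : Prop :=
  ∀ i, FairProc I r i ∧ FairDisp r i

/-! ### Operations in a run

An operation in a run is given by its process `i` and its starting time `s`: the
environment invokes it at `i` in the round from time `s` to time `s + 1`. -/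

/-- Operation `o` is invoked at `α.1` at time `α.2`. -/
def Invoked {n : ℕ} {X D A L : Type*} (r : Run n X D A L) (α : Fin n × ℕ) (o : Op A) : Prop :=
  (r.act α.2).env α.1 = some o

/-- The operation `α` ends at time `e`, that is, its matching return action is performed in the
round from time `e - 1` to time `e`, and the response is `p`. -/
def EndsAt {n : ℕ} {X D A L : Type*} (r : Run n X D A L) (α : Fin n × ℕ) (e : ℕ) (p : Resp A) :
    Prop :=
  ∃ t, e = t + 1 ∧ α.2 < t ∧ (r.act t).proc α.1 = .ret p ∧
    ∀ u, α.2 < u → u < t → ∀ q, (r.act u).proc α.1 ≠ .ret q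

/-- Real-time order: `α` ends strictly before the starting time of `β`. -/
def Precedes {n : ℕ} {X D A L : Type*} (r : Run n X D A L) (α β : Fin n × ℕ) : Prop :=
  ∃ e p, EndsAt r α e p ∧ e < β.2

/-- No operation of `r` is concurrent with `α`. -/
def InIsolation {n : ℕ} {X D A L : Type*} (r : Run n X D A L) (α : Fin n × ℕ) : Prop :=
  ∀ β o, Invoked r β o → β ≠ α → Precedes r α β ∨ Precedes r β α

/-- No agents other than `i` and its dispatcher move at times `t` with `s ≤ t < e`. -/
def Solo {n : ℕ} {X D A L : Type*} (r : Run n X D A L) (i : Fin n) (s e : ℕ) : Prop :=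
  ∀ t, s ≤ t → t < e → ∀ k, k ≠ i → (r.act t).proc k = .null ∧ (r.act t).disp k = false

/-- Process `i` performs a fence or a read-modify-write after the invocation at time `s` and
before time `e`. (The action of `i` at time `s` itself is chosen before the invocation.) -/
def ContainsSync {n : ℕ} {X D A L : Type*} (r : Run n X D A L) (i : Fin n) (s e : ℕ) : Prop :=
  ∃ t, s < t ∧ t < e ∧ ((r.act t).proc i).IsSync

/-- An operation with response `p` that is a read returning `v` or a write of `v`. -/
def IsValueOp {A : Type*} (v : A) (o : Op A) (p : Resp A) : Prop :=
  (o = .read ∧ p = .value v) ∨ (o = .write v ∧ p = .ack)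

/-! ### Correctness conditions -/

/-- The run is linearizable with respect to the register with default value `v₀`: there are a set
`C` of operations of `r`, which contains every operation that completes (and possibly some that do
not), and a linear order on `C`, given by distinct positions, that extends the real-time order and
in which every completed read returns the value of the last write before it, or `v₀` if there is no
write before it. -/
def LinearizableRun {n : ℕ} {X D A L : Type*} (v₀ : A) (r : Run n X D A L) : Prop :=
  ∃ (C : Set (Fin n × ℕ)) (pos : Fin n × ℕ → ℕ),
    (∀ α ∈ C, ∃ o, Invoked r α o) ∧
    (∀ α o e p, Invoked r α o → EndsAt r α e p → α ∈ C) ∧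
    Set.InjOn pos C ∧
    (∀ α ∈ C, ∀ β ∈ C, Precedes r α β → pos α < pos β) ∧
    ∀ α e v, Invoked r α .read → EndsAt r α e (.value v) →
      (∃ β ∈ C, Invoked r β (.write v) ∧ pos β < pos α ∧
        ∀ γ ∈ C, ∀ w, Invoked r γ (.write w) → pos γ < pos α → pos γ ≤ pos β) ∨
      (v = v₀ ∧ ∀ γ ∈ C, ∀ w, Invoked r γ (.write w) → ¬ pos γ < pos α)

/-- `I` is a linearizable implementation of a register with default value `v₀`. -/
def Linearizable {n : ℕ} {X D A L : Type*} [DecidableEq X] (I : Implementation n X D A L)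
    (v₀ : A) : Prop :=
  ∀ r, IsExecution I r → IsFair I r → LinearizableRun v₀ r

/-- `I` is obstruction-free: if from some time on only process `i` and its dispatcher move, and
these are scheduled fairly, then an operation that is pending at `i` completes. -/
def ObstructionFree {n : ℕ} {X D A L : Type*} [DecidableEq X] (I : Implementation n X D A L) :
    Prop :=
  ∀ r, IsExecution I r → ∀ i T, pending ((r.state T).loc i) ≠ none →
    (∀ e, Solo r i T e) → FairProc I r i → FairDisp r i →
    ∃ t p, T ≤ t ∧ (r.act t).proc i = .ret p

/-- Process `i` has the same local states in `r` and `r'` until time `e`. -/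
def IndistUntil {n : ℕ} {X D A L : Type*} (r r' : Run n X D A L) (i : Fin n) (e : ℕ) : Prop :=
  ∀ t, t ≤ e → (r'.state t).loc i = (r.state t).loc i

end TSO

/-!
Suppose that the `Write(b)` performed by `j` after `X` contained no fence and no read-modify-write
either. What an operation of this kind does depends only on the local state of its process and on
the values that its reads return, and a process does not see the propagations of its own
dispatcher: moving the oldest item of its buffer to memory leaves every value that it reads the
same. So both operations can be replayed, without any propagation, from the state in which `X` is
invoked. Each of them then only appends items to the buffer of its own process, which the other
process cannot see. Hence they can be run in either order, with the same responses and with the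
same final state.

If `X` is a read, then run after `Write(b)` it still returns `a ≠ b`. If `X` is a write, then a
subsequent solo read, which completes by obstruction-freedom, has to return `a` for one order and
`b` for the other. Both contradict linearizability.
-/

namespace TSO

variable {n : ℕ} {X D A L : Type*}

/-! ### Rounds -/

namespace Joint

/-- The agent performs a non-null action. -/
def Moves (a : Joint n X D A L) : Agent n → Prop
  | .proc i => a.proc i ≠ .null
  | .disp i => a.disp i = true

/-- No agents other than `k` and its dispatcher move. -/
def SoloBy (a : Joint n X D A L) (k : Fin n) : Prop :=
  ∀ i, i ≠ k → a.proc i = .null ∧ a.disp i = false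

/-- The round in which no agent moves and nothing is invoked. -/
def idle : Joint n X D A L where
  proc _ := .null
  disp _ := false
  env _ := none

/-- The round in which `o` is invoked at `k` and nothing else happens. -/
def invoke (k : Fin n) (o : Op A) : Joint n X D A L :=
  { idle with env := Function.update (fun _ => none) k (some o) }

/-- The round in which `k` performs `a` and nothing else happens. -/
def single (k : Fin n) (a : Act X D A L) : Joint n X D A L where
  proc := Function.update (fun _ => .null) k a
  disp _ := false
  env _ := none

/-- The round in which the dispatcher of `k` propagates and nothing else happens. -/
def propagate (k : Fin n) : Joint n X D A L :=
  { idle with disp := Function.update (fun _ => false) k true }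

/-- The round in which the agents act as in `a` and nothing is invoked. -/
def withoutInvocations (a : Joint n X D A L) : Joint n X D A L :=
  { a with env := fun _ => none }

theorem soloBy_of_forall_moves {a : Joint n X D A L} {k : Fin n}
    (h : ∀ c, a.Moves c → c = .proc k ∨ c = .disp k) : a.SoloBy k := by
  refine fun i hi => ⟨?_, ?_⟩
  · by_contra hmove
    simpa [hi] using h (.proc i) hmove
  · by_contra hmove
    simpa [hi] using h (.disp i) (by simpa [Moves] using hmove)

theorem soloBy_single (k : Fin n) (a : Act X D A L) : (single k a).SoloBy k :=
  fun i hi => ⟨by simp [single, hi], rfl⟩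

theorem not_moves_idle (c : Agent n) : ¬ (idle : Joint n X D A L).Moves c := by
  cases c <;> simp [Moves, idle]

theorem not_moves_invoke (k : Fin n) (o : Op A) (c : Agent n) :
    ¬ (invoke k o : Joint n X D A L).Moves c := by
  cases c <;> simp [Moves, invoke, idle]

theorem eq_of_moves_single {k : Fin n} {a : Act X D A L} {c : Agent n}
    (h : (single k a).Moves c) : c = .proc k := by
  cases c with
  | proc i =>
    by_contra hne
    have hik : i ≠ k := fun hik => hne (by rw [hik])
    simp [Moves, single, hik] at h
  | disp i => simp [Moves, single] at h

theorem eq_of_moves_propagate {k : Fin n} {c : Agent n}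
    (h : (propagate k : Joint n X D A L).Moves c) : c = .disp k := by
  cases c with
  | proc i => simp [Moves, propagate, idle] at h
  | disp i =>
    by_contra hne
    have hik : i ≠ k := fun hik => hne (by rw [hik])
    simp [Moves, propagate, hik] at h

end Joint

/-- The state `g` after an invocation of `o` at `k`. -/
def Global.invoke (g : Global n X D A L) (k : Fin n) (o : Op A) : Global n X D A L :=
  { g with loc := Function.update g.loc k (g.loc k ++ [.invoke o]) }

/-- The state `g` after `k` has appended `β` to its buffer and has come to the local state `l`. -/
def Global.buffered (g : Global n X D A L) (k : Fin n) (β : List (X × D)) (l : Local X D A L) :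
    Global n X D A L where
  tso := { g.tso with buf := Function.update g.tso.buf k (g.tso.buf k ++ β) }
  loc := Function.update g.loc k l

theorem Global.buffered_comm (g : Global n X D A L) {i j : Fin n} (hij : i ≠ j)
    (β β' : List (X × D)) (l l' : Local X D A L) :
    (g.buffered i β l).buffered j β' l' = (g.buffered j β' l').buffered i β l := by
  simp only [Global.buffered, Function.update_of_ne hij, Function.update_of_ne hij.symm,
    Function.update_comm hij]

theorem Global.buffered_invoke (g : Global n X D A L) (k : Fin n) (o : Op A)
    (β : List (X × D)) (l : Local X D A L) :
    (g.invoke k o).buffered k β l = g.buffered k β l := by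
  simp [Global.buffered, Global.invoke]

theorem Global.loc_buffered_of_ne (g : Global n X D A L) {i k : Fin n} (h : i ≠ k)
    (β : List (X × D)) (l : Local X D A L) : (g.buffered k β l).loc i = g.loc i :=
  Function.update_of_ne h _ _

theorem foldl_eq_of_forall_ne {ι S : Type*} {f : S → ι → S} {k : ι}
    (hf : ∀ σ i, i ≠ k → f σ i = σ) {l : List ι} (hl : l.Nodup) (hk : k ∈ l) (σ : S) :
    l.foldl f σ = f σ k := by
  obtain ⟨l₁, l₂, rfl⟩ := List.append_of_mem hk
  have hfix : ∀ l' : List ι, k ∉ l' → ∀ τ, l'.foldl f τ = τ := by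
    intro l' hl' τ
    induction l' generalizing τ with
    | nil => rfl
    | cons i l' ih =>
      rw [List.mem_cons, not_or] at hl'
      rw [List.foldl_cons, hf τ i (Ne.symm hl'.1), ih hl'.2]
  rw [List.nodup_middle, List.nodup_cons, List.mem_append, not_or] at hl
  rw [List.foldl_append, List.foldl_cons, hfix l₁ hl.1.1, hfix l₂ hl.1.2]

/-! ### Pending operations -/

theorem pending_append_singleton (l : Local X D A L) (ev : Event X D A L) :
    pending (l ++ [ev]) = ev.updPending (pending l) := by
  simp [pending]

theorem Global.pending_invoke (g : Global n X D A L) (k : Fin n) (o : Op A) :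
    pending ((g.invoke k o).loc k) = some o := by
  simp [Global.invoke, pending_append_singleton, Event.updPending]

section

variable [DecidableEq X]

theorem pending_append_record (l : Local X D A L) (σ : MemState n X D) (k : Fin n)
    {a : Act X D A L} (ha : ∀ p, a ≠ .ret p) : pending (l ++ record σ k a) = pending l := by
  cases a with
  | null => simp [record]
  | ret p => exact absurd rfl (ha p)
  | _ => exact pending_append_singleton _ _

theorem pending_append_record_ret (l : Local X D A L) (σ : MemState n X D) (k : Fin n)
    (p : Resp A) : pending (l ++ record σ k (.ret p : Act X D A L)) = none :=
  pending_append_singleton _ _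

theorem next_loc (g : Global n X D A L) (a : Joint n X D A L) (k : Fin n) :
    (next g a).loc k = g.loc k ++ record g.tso k (a.proc k) ++
      ((a.env k).map Event.invoke).toList := rfl

theorem next_loc_of_env_eq_none {g : Global n X D A L} {a : Joint n X D A L} {k : Fin n}
    (h : a.env k = none) : (next g a).loc k = g.loc k ++ record g.tso k (a.proc k) := by
  simp [next_loc, h]

theorem pending_next_of_env_eq_some {g : Global n X D A L} {a : Joint n X D A L} {k : Fin n}
    {o : Op A} (h : a.env k = some o) : pending ((next g a).loc k) = some o := by
  rw [next_loc, h]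
  exact pending_append_singleton _ _

theorem pending_next_of_ne_ret {g : Global n X D A L} {a : Joint n X D A L} {k : Fin n}
    (henv : a.env k = none) (hret : ∀ p, a.proc k ≠ .ret p) :
    pending ((next g a).loc k) = pending (g.loc k) := by
  rw [next_loc_of_env_eq_none henv, pending_append_record _ _ _ hret]

/-! ### Effects of rounds -/

theorem next_tso_of_soloBy {g : Global n X D A L} {a : Joint n X D A L} {k : Fin n}
    (ha : a.SoloBy k) :
    (next g a).tso = if a.disp k then propEffect (actEffect g.tso k (a.proc k)) k
      else actEffect g.tso k (a.proc k) := by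
  simp only [next]
  rw [foldl_eq_of_forall_ne (k := k) (fun σ i hi => by simp [(ha i hi).2])
      (List.nodup_finRange n) (List.mem_finRange k),
    foldl_eq_of_forall_ne (k := k) (fun σ i hi => by simp [(ha i hi).1, actEffect])
      (List.nodup_finRange n) (List.mem_finRange k)]

theorem next_idle (g : Global n X D A L) : next g .idle = g := by
  simp [next, Joint.idle, actEffect, record]

theorem next_invoke (g : Global n X D A L) (k : Fin n) (o : Op A) :
    next g (.invoke k o) = g.invoke k o := by
  simp only [next, Joint.invoke, Joint.idle, actEffect, record, Global.invoke,
    Bool.false_eq_true, if_false, List.foldl_fixed, List.append_nil, Global.mk.injEq, true_and]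
  funext i
  by_cases hik : i = k
  · subst hik; simp
  · simp [hik]

theorem next_single (g : Global n X D A L) (k : Fin n) (a : Act X D A L) :
    next g (.single k a) =
      ⟨actEffect g.tso k a, Function.update g.loc k (g.loc k ++ record g.tso k a)⟩ := by
  have htso : (next g (.single k a)).tso = actEffect g.tso k a := by
    rw [next_tso_of_soloBy (Joint.soloBy_single k a)]
    simp [Joint.single]
  have hloc : (next g (.single k a)).loc =
      Function.update g.loc k (g.loc k ++ record g.tso k a) := by
    funext i
    rw [next_loc_of_env_eq_none rfl]
    by_cases hik : i = k
    · subst hik; simp [Joint.single]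
    · simp [Joint.single, hik, record]
  exact congrArg₂ Global.mk htso hloc

theorem next_eq_invoke {g : Global n X D A L} {a : Joint n X D A L} {k : Fin n} {o : Op A}
    (hk : a.env k = some o) (hne : ∀ i, i ≠ k → a.env i = none) :
    next g a = (next g a.withoutInvocations).invoke k o := by
  refine congrArg (Global.mk _) (funext fun i => ?_)
  by_cases hik : i = k
  · subst hik; simp [next_loc, hk, Joint.withoutInvocations]
  · simp [next_loc, hne i hik, hik, Joint.withoutInvocations]

theorem actEffect_buf_ne_nil {σ : MemState n X D} {i : Fin n} (h : σ.buf i ≠ []) (k : Fin n)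
    (a : Act X D A L) : (actEffect σ k a).buf i ≠ [] := by
  cases a with
  | write x v =>
    by_cases hik : i = k
    · subst hik; simp [actEffect]
    · simpa [actEffect, hik] using h
  | _ => exact h

theorem propEffect_buf_of_ne (σ : MemState n X D) {i k : Fin n} (hik : i ≠ k) :
    (propEffect σ k).buf i = σ.buf i := by
  unfold propEffect
  split
  · rfl
  · simp [hik]

theorem next_buf_ne_nil {g : Global n X D A L} {a : Joint n X D A L} {i : Fin n}
    (h : g.tso.buf i ≠ []) (ha : a.disp i = false) : (next g a).tso.buf i ≠ [] := by
  refine List.foldlRecOn (motive := fun σ : MemState n X D => σ.buf i ≠ []) _ _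
    (List.foldlRecOn (motive := fun σ : MemState n X D => σ.buf i ≠ []) _ _ h
      fun σ hσ k _ => actEffect_buf_ne_nil hσ k _) fun σ hσ k _ => ?_
  by_cases hik : i = k
  · subst hik; simpa [ha] using hσ
  · split
    · rwa [propEffect_buf_of_ne σ hik]
    · exact hσ

/-! ### Legal rounds -/

theorem Accesses.moves {σ : MemState n X D} {a : Joint n X D A L} {c : Agent n} {x : X}
    (h : Accesses σ a c x) : a.Moves c := by
  cases c with
  | proc i =>
    rcases h with ⟨hread, -⟩ | hprop | ⟨exp, new, hrmw⟩
    · simp [Joint.Moves, hread]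
    · exact hprop.elim
    · simp [Joint.Moves, hrmw]
  | disp i =>
    rcases h with hread | ⟨hprop, -⟩ | hrmw
    · exact hread.elim
    · exact hprop
    · exact hrmw.elim

theorem not_conflict_of_forall_moves {σ : MemState n X D} {a : Joint n X D A L} {c : Agent n}
    (h : ∀ b, a.Moves b → b = c) (b b' : Agent n) (hne : b ≠ b') : ¬ Conflict σ a b b' := by
  rintro ⟨x, hb, hb', -⟩
  exact hne ((h b hb.moves).trans (h b' hb'.moves).symm)

/-- The round `a` is possible in the state `g`, and the processes follow their protocols. -/
structure IsRound (I : Implementation n X D A L) (g : Global n X D A L)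
    (a : Joint n X D A L) : Prop where
  enabled : JointEnabled g a
  follows : ∀ i, a.proc i ≠ .null → a.proc i ∈ I.protocol i (g.loc i)

variable {I : Implementation n X D A L} {g : Global n X D A L}

theorem isRound_idle (I : Implementation n X D A L) (g : Global n X D A L) :
    IsRound I g .idle where
  enabled :=
    { proc := fun _ => trivial
      disp := fun _ h => by simp [Joint.idle] at h
      env := fun _ h => absurd rfl h
      no_conflict := fun b _ _ ⟨_, hb, _⟩ => Joint.not_moves_idle b hb.moves }
  follows _ h := absurd rfl h

theorem isRound_invoke {k : Fin n} (h : pending (g.loc k) = none) (o : Op A) :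
    IsRound I g (.invoke k o) where
  enabled :=
    { proc := fun _ => trivial
      disp := fun _ h => by simp [Joint.invoke, Joint.idle] at h
      env := fun i hi => by
        obtain rfl : i = k := by
          by_contra hik
          simp [Joint.invoke, hik] at hi
        simpa [Joint.invoke, Joint.idle, record] using h
      no_conflict := fun b _ _ ⟨_, hb, _⟩ => Joint.not_moves_invoke k o b hb.moves }
  follows _ h := absurd rfl h

theorem isRound_single {k : Fin n} {a : Act X D A L} (hen : ActEnabled g k a)
    (hfol : a ≠ .null → a ∈ I.protocol k (g.loc k)) : IsRound I g (.single k a) where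
  enabled :=
    { proc := fun i => by
        by_cases hik : i = k
        · subst hik; simpa [Joint.single] using hen
        · simp [Joint.single, hik, ActEnabled]
      disp := fun _ h => by simp [Joint.single] at h
      env := fun _ h => absurd rfl h
      no_conflict := not_conflict_of_forall_moves fun _ => Joint.eq_of_moves_single }
  follows i hi := by
    obtain rfl : i = k := Agent.proc.inj (Joint.eq_of_moves_single (c := .proc i) hi)
    simp only [Joint.single, Function.update_self] at hi ⊢
    exact hfol hi

theorem isRound_propagate {k : Fin n} (h : g.tso.buf k ≠ []) : IsRound I g (.propagate k) where
  enabled :=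
    { proc := fun _ => trivial
      disp := fun i hi => by
        obtain rfl : i = k := Agent.disp.inj (Joint.eq_of_moves_propagate (c := .disp i) hi)
        exact h
      env := fun _ h => absurd rfl h
      no_conflict := not_conflict_of_forall_moves fun _ => Joint.eq_of_moves_propagate }
  follows _ h := absurd rfl h

theorem IsRound.withoutInvocations {a : Joint n X D A L} (h : IsRound I g a) :
    IsRound I g a.withoutInvocations where
  enabled :=
    { proc := h.enabled.proc
      disp := h.enabled.disp
      env := fun _ hi => absurd rfl hi
      no_conflict := h.enabled.no_conflict }
  follows := h.follows

end

/-! ### Views -/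

section

variable [DecidableEq X]

theorem bufLookup_append_singleton (β : List (X × D)) (y : X) (v : D) (x : X) :
    bufLookup (β ++ [(y, v)]) x = if y = x then some v else bufLookup β x := by
  unfold bufLookup
  rw [List.filter_append]
  by_cases h : y = x <;> simp [h]

theorem bufLookup_cons (β : List (X × D)) (y : X) (v : D) (x : X) :
    bufLookup ((y, v) :: β) x = (bufLookup β x).or (if y = x then some v else none) := by
  unfold bufLookup
  by_cases h : y = x
  · simp only [List.filter_cons, h, decide_true, if_true, List.getLast?_cons]
    cases (List.filter (fun p : X × D => decide (p.1 = x)) β).getLast? <;> simp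
  · simp [h]

theorem readVal_propEffect (σ : MemState n X D) (k : Fin n) :
    readVal (propEffect σ k) k = readVal σ k := by
  funext x
  unfold propEffect
  split
  · rfl
  · next y v β h =>
    simp only [readVal, h, Function.update_self, bufLookup_cons]
    rcases bufLookup β x with _ | w
    · by_cases hx : x = y
      · subst hx; simp
      · simp [hx, Ne.symm hx]
    · simp

theorem readVal_actEffect_write (σ : MemState n X D) (k : Fin n) (y : X) (v : D) :
    readVal (actEffect σ k (.write y v : Act X D A L)) k =
      Function.update (readVal σ k) y v := by
  funext x
  simp only [readVal, actEffect, Function.update_self, bufLookup_append_singleton]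
  by_cases hx : x = y
  · subst hx; simp
  · simp [hx, Ne.symm hx, readVal]

theorem readVal_actEffect_congr {σ σ' : MemState n X D} {k : Fin n} {a : Act X D A L}
    (ha : ¬ a.IsSync) (h : readVal σ k = readVal σ' k) :
    readVal (actEffect σ k a) k = readVal (actEffect σ' k a) k := by
  cases a with
  | write y v => rw [readVal_actEffect_write, readVal_actEffect_write, h]
  | rmw => exact absurd trivial ha
  | _ => exact h

theorem record_congr {σ σ' : MemState n X D} {k : Fin n} (a : Act X D A L)
    (h : readVal σ k = readVal σ' k) : record σ k a = record σ' k a := by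
  cases a with
  | read x => simp only [record, h]
  | _ => rfl

theorem exists_actEffect_eq_append (k : Fin n) {a : Act X D A L} (ha : ¬ a.IsSync) :
    ∃ β : List (X × D), ∀ σ : MemState n X D,
      actEffect σ k a = { σ with buf := Function.update σ.buf k (σ.buf k ++ β) } := by
  cases a with
  | write y v => exact ⟨[(y, v)], fun σ => rfl⟩
  | rmw => exact absurd trivial ha
  | _ => exact ⟨[], fun σ => by simp [actEffect]⟩

/-- Process `k` cannot distinguish `g` from `g'`: it has the same local state in both, and its
reads return the same values, though possibly from different sources. -/
def SameView (k : Fin n) (g g' : Global n X D A L) : Prop :=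
  readVal g.tso k = readVal g'.tso k ∧ g.loc k = g'.loc k

theorem SameView.symm {k : Fin n} {g g' : Global n X D A L} (h : SameView k g g') :
    SameView k g' g :=
  ⟨h.1.symm, h.2.symm⟩

theorem SameView.trans {k : Fin n} {g g' g'' : Global n X D A L} (h : SameView k g g')
    (h' : SameView k g' g'') : SameView k g g'' :=
  ⟨h.1.trans h'.1, h.2.trans h'.2⟩

theorem readVal_next_of_soloBy {g : Global n X D A L} {a : Joint n X D A L} {k : Fin n}
    (ha : a.SoloBy k) :
    readVal (next g a).tso k = readVal (actEffect g.tso k (a.proc k)) k := by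
  rw [next_tso_of_soloBy ha]
  split
  · exact readVal_propEffect _ k
  · rfl

theorem SameView.next {k : Fin n} {g g' : Global n X D A L} {a a' : Joint n X D A L}
    (h : SameView k g g') (ha : a.SoloBy k) (ha' : a'.SoloBy k) (hsync : ¬ (a.proc k).IsSync)
    (hproc : a'.proc k = a.proc k) (henv : a'.env k = a.env k) :
    SameView k (next g a) (next g' a') := by
  refine ⟨?_, ?_⟩
  · rw [readVal_next_of_soloBy ha, readVal_next_of_soloBy ha', hproc,
      readVal_actEffect_congr hsync h.1]
  · rw [next_loc, next_loc, hproc, henv, h.2, record_congr _ h.1]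

theorem SameView.invoke {k : Fin n} {g g' : Global n X D A L} (h : SameView k g g') (o : Op A) :
    SameView k (g.invoke k o) (g'.invoke k o) :=
  ⟨h.1, by simp only [Global.invoke, Function.update_self, h.2]⟩

theorem sameView_invoke {i k : Fin n} (h : k ≠ i) (g : Global n X D A L) (o : Op A) :
    SameView k g (g.invoke i o) :=
  ⟨rfl, (Function.update_of_ne h _ _).symm⟩

theorem sameView_buffered {i k : Fin n} (h : k ≠ i) (g : Global n X D A L) (β : List (X × D))
    (l : Local X D A L) : SameView k g (g.buffered i β l) :=
  ⟨funext fun x => by simp [readVal, Global.buffered, h], (g.loc_buffered_of_ne h β l).symm⟩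

end

/-! ### Runs -/

namespace Run

/-- The run that follows `r` until time `T` and `q` afterwards. -/
def splice (r : Run n X D A L) (T : ℕ) (q : Run n X D A L) : Run n X D A L where
  state t := if t < T then r.state t else q.state (t - T)
  act t := if t < T then r.act t else q.act (t - T)

/-- The part of `r` from time `T` on. -/
def drop (r : Run n X D A L) (T : ℕ) : Run n X D A L where
  state t := r.state (T + t)
  act t := r.act (T + t)

/-- The values whose writing is invoked before time `T`. -/
def written (r : Run n X D A L) (T : ℕ) : Set A :=
  {v | ∃ t < T, ∃ k, Invoked r (k, t) (.write v)}

variable {r q : Run n X D A L} {T M t : ℕ}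

theorem splice_act_of_lt (h : t < T) : (r.splice T q).act t = r.act t :=
  if_pos h

theorem splice_act_add (r q : Run n X D A L) (T u : ℕ) :
    (r.splice T q).act (T + u) = q.act u := by
  simp [splice]

theorem splice_state_add (r q : Run n X D A L) (T u : ℕ) :
    (r.splice T q).state (T + u) = q.state u := by
  simp [splice]

theorem splice_state_of_le (hq : q.state 0 = r.state T) (h : t ≤ T) :
    (r.splice T q).state t = r.state t := by
  rcases h.lt_or_eq with h | rfl
  · exact if_pos h
  · rw [← hq]
    exact splice_state_add r q t 0

theorem drop_splice (r q : Run n X D A L) (T : ℕ) : (r.splice T q).drop T = q := by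
  simp [drop, splice_act_add, splice_state_add]

theorem invoked_splice_of_lt {k : Fin n} {o : Op A} (h : t < T) :
    Invoked (r.splice T q) (k, t) o ↔ Invoked r (k, t) o := by
  simp only [Invoked, splice_act_of_lt h]

theorem invoked_splice_add {k : Fin n} {u : ℕ} {o : Op A} :
    Invoked (r.splice T q) (k, T + u) o ↔ Invoked q (k, u) o := by
  simp only [Invoked, splice_act_add]

theorem written_splice_subset (r q : Run n X D A L) (T M : ℕ) :
    (r.splice T q).written (T + M) ⊆ r.written T ∪ q.written M := by
  rintro v ⟨t, ht, k, hk⟩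
  rcases lt_or_ge t T with h | h
  · exact .inl ⟨t, h, k, (invoked_splice_of_lt h).1 hk⟩
  · obtain ⟨u, rfl⟩ := Nat.exists_eq_add_of_le h
    exact .inr ⟨u, by omega, k, invoked_splice_add.1 hk⟩

theorem written_eq_empty (h : ∀ t < M, ∀ k, (q.act t).env k = none) : q.written M = ∅ := by
  refine Set.eq_empty_of_forall_notMem fun v ⟨t, ht, k, hk⟩ => ?_
  simp [Invoked, h t ht k] at hk

end Run

theorem EndsAt.lt {r : Run n X D A L} {α : Fin n × ℕ} {e : ℕ} {p : Resp A}
    (h : EndsAt r α e p) : α.2 + 1 < e := by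
  obtain ⟨t, rfl, hlt, -⟩ := h
  omega

theorem EndsAt.congr {r r' : Run n X D A L} {α : Fin n × ℕ} {e : ℕ} {p : Resp A}
    (h : EndsAt r α e p) (hr : ∀ t < e, r'.act t = r.act t) : EndsAt r' α e p := by
  obtain ⟨t, rfl, hlt, hret, hfirst⟩ := h
  refine ⟨t, rfl, hlt, by rw [hr t (by omega), hret], fun u hu hut q => ?_⟩
  rw [hr u (by omega)]
  exact hfirst u hu hut q

theorem EndsAt.unique {r : Run n X D A L} {α : Fin n × ℕ} {e e' : ℕ} {p p' : Resp A}
    (h : EndsAt r α e p) (h' : EndsAt r α e' p') : e = e' := by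
  obtain ⟨t, rfl, hlt, hret, hfirst⟩ := h
  obtain ⟨t', rfl, hlt', hret', hfirst'⟩ := h'
  rcases lt_trichotomy t t' with h | h | h
  · exact absurd hret (hfirst' t hlt h p)
  · rw [h]
  · exact absurd hret' (hfirst t' hlt' h p')

theorem EndsAt.splice_add {q : Run n X D A L} {k : Fin n} {s e : ℕ} {p : Resp A}
    (h : EndsAt q (k, s) e p) (r : Run n X D A L) (T : ℕ) :
    EndsAt (r.splice T q) (k, T + s) (T + e) p := by
  obtain ⟨t, rfl, hlt, hret, hfirst⟩ := h
  dsimp only at hlt hret hfirst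
  refine ⟨T + t, by omega, by dsimp only; omega, by rw [Run.splice_act_add]; exact hret,
    fun u hu hut p' => ?_⟩
  dsimp only at hu
  obtain ⟨v, rfl⟩ := Nat.exists_eq_add_of_le (show T ≤ u by omega)
  rw [Run.splice_act_add]
  exact hfirst v (by omega) (by omega) p'

/-- Every operation invoked before time `T` completes by time `T`. -/
def Quiet (r : Run n X D A L) (T : ℕ) : Prop :=
  ∀ k t o, t < T → Invoked r (k, t) o → ∃ e p, EndsAt r (k, t) e p ∧ e ≤ T

theorem InIsolation.exists_endsAt_lt {r : Run n X D A L} {α β : Fin n × ℕ} {e : ℕ} {p : Resp A}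
    {o : Op A} (hα : InIsolation r α) (hend : EndsAt r α e p) (hβ : Invoked r β o) (hne : β ≠ α)
    (hβe : β.2 < e) : ∃ e' p', EndsAt r β e' p' ∧ e' < α.2 := by
  rcases hα β o hβ hne with ⟨e', p', hend', hlt⟩ | hprec
  · have := hend.unique hend'
    omega
  · exact hprec

section

variable [DecidableEq X]

/-- The first `M` rounds of `q` are possible, and write each value at most once. -/
structure IsPath (I : Implementation n X D A L) (q : Run n X D A L) (M : ℕ) : Prop where
  round : ∀ t < M, IsRound I (q.state t) (q.act t)
  step : ∀ t < M, q.state (t + 1) = next (q.state t) (q.act t)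
  write_once : ∀ v t t' i i', t < M → t' < M → Invoked q (i, t) (.write v) →
    Invoked q (i', t') (.write v) → t = t' ∧ i = i'

/-- A global state in which an execution of `I` may start. -/
structure IsInitial (I : Implementation n X D A L) (g : Global n X D A L) : Prop where
  mem : g.tso.mem ∈ I.initMem
  buf : ∀ i, g.tso.buf i = []
  loc : ∀ i, g.loc i = []

variable {I : Implementation n X D A L} {r q : Run n X D A L} {T M : ℕ}

theorem IsExecution.isInitial (h : IsExecution I r) : IsInitial I (r.state 0) :=
  ⟨h.mem_zero, h.buf_zero, h.loc_zero⟩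

theorem IsExecution.isPath (h : IsExecution I r) (T : ℕ) : IsPath I r T where
  round t _ := ⟨h.enabled t, h.follows t⟩
  step t _ := h.step t
  write_once v t t' i i' _ _ := h.write_once v t t' i i'

theorem isExecution_of_isPath (hinit : IsInitial I (r.state 0)) (h : ∀ T, IsPath I r T) :
    IsExecution I r where
  mem_zero := hinit.mem
  buf_zero := hinit.buf
  loc_zero := hinit.loc
  enabled t := ((h (t + 1)).round t t.lt_succ_self).enabled
  step t := (h (t + 1)).step t t.lt_succ_self
  follows t := ((h (t + 1)).round t t.lt_succ_self).follows
  write_once v t t' i i' := (h (t + t' + 1)).write_once v t t' i i' (by omega) (by omega)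

theorem isPath_of_env_eq_none (hround : ∀ t < M, IsRound I (q.state t) (q.act t))
    (hstep : ∀ t < M, q.state (t + 1) = next (q.state t) (q.act t))
    (henv : ∀ t < M, ∀ i, (q.act t).env i = none) : IsPath I q M where
  round := hround
  step := hstep
  write_once v t _ i _ ht _ h _ := by simp [Invoked, henv t ht i] at h

theorem IsPath.mono (h : IsPath I r T) (hM : M ≤ T) : IsPath I r M where
  round t ht := h.round t (ht.trans_le hM)
  step t ht := h.step t (ht.trans_le hM)
  write_once v t t' i i' ht ht' :=
    h.write_once v t t' i i' (ht.trans_le hM) (ht'.trans_le hM)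

theorem IsPath.drop (h : IsPath I r (T + M)) : IsPath I (r.drop T) M where
  round t ht := h.round (T + t) (by omega)
  step t ht := h.step (T + t) (by omega)
  write_once v t t' i i' ht ht' hv hv' := by
    obtain ⟨htt', hi⟩ := h.write_once v (T + t) (T + t') i i' (by omega) (by omega) hv hv'
    exact ⟨by omega, hi⟩

theorem IsPath.append (hr : IsPath I r T) (hq : IsPath I q M) (h0 : q.state 0 = r.state T)
    (hdisj : Disjoint (r.written T) (q.written M)) : IsPath I (r.splice T q) (T + M) where
  round t ht := by
    rcases lt_or_ge t T with h | h
    · rw [Run.splice_state_of_le h0 h.le, Run.splice_act_of_lt h]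
      exact hr.round t h
    · obtain ⟨u, rfl⟩ := Nat.exists_eq_add_of_le h
      rw [Run.splice_state_add, Run.splice_act_add]
      exact hq.round u (by omega)
  step t ht := by
    rcases lt_or_ge t T with h | h
    · rw [Run.splice_state_of_le h0 h.le, Run.splice_state_of_le h0 (Nat.succ_le_of_lt h),
        Run.splice_act_of_lt h]
      exact hr.step t h
    · obtain ⟨u, rfl⟩ := Nat.exists_eq_add_of_le h
      rw [add_assoc, Run.splice_state_add, Run.splice_state_add, Run.splice_act_add]
      exact hq.step u (by omega)
  write_once v t t' i i' ht ht' hv hv' := by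
    have hdisj : v ∈ r.written T → v ∉ q.written M := fun h h' =>
      Set.disjoint_left.1 hdisj h h'
    rcases lt_or_ge t T with h | h <;> rcases lt_or_ge t' T with h' | h'
    · rw [Run.invoked_splice_of_lt h] at hv
      rw [Run.invoked_splice_of_lt h'] at hv'
      exact hr.write_once v t t' i i' h h' hv hv'
    · obtain ⟨u', rfl⟩ := Nat.exists_eq_add_of_le h'
      rw [Run.invoked_splice_of_lt h] at hv
      rw [Run.invoked_splice_add] at hv'
      exact absurd ⟨u', by omega, i', hv'⟩ (hdisj ⟨t, h, i, hv⟩)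
    · obtain ⟨u, rfl⟩ := Nat.exists_eq_add_of_le h
      rw [Run.invoked_splice_add] at hv
      rw [Run.invoked_splice_of_lt h'] at hv'
      exact absurd ⟨u, by omega, i, hv⟩ (hdisj ⟨t', h', i', hv'⟩)
    · obtain ⟨u, rfl⟩ := Nat.exists_eq_add_of_le h
      obtain ⟨u', rfl⟩ := Nat.exists_eq_add_of_le h'
      rw [Run.invoked_splice_add] at hv hv'
      obtain ⟨rfl, rfl⟩ := hq.write_once v u u' i i' (by omega) (by omega) hv hv'
      exact ⟨rfl, rfl⟩

theorem IsPath.exists_invoked_of_pending (hr : IsPath I r T) (h0 : IsInitial I (r.state 0))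
    {k : Fin n} {o : Op A} (h : pending ((r.state T).loc k) = some o) :
    ∃ t < T, Invoked r (k, t) o ∧ ∀ u, t < u → u < T → ∀ p, (r.act u).proc k ≠ .ret p := by
  induction T with
  | zero => simp [h0.loc, pending] at h
  | succ T ih =>
    rw [hr.step T T.lt_succ_self] at h
    rcases henv : (r.act T).env k with _ | o'
    · have hret : ∀ p, (r.act T).proc k ≠ .ret p := by
        rintro p hp
        rw [next_loc_of_env_eq_none henv, hp, pending_append_record_ret] at h
        cases h
      rw [pending_next_of_ne_ret henv hret] at h
      obtain ⟨t, ht, hinv, hfirst⟩ := ih (hr.mono T.le_succ) h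
      refine ⟨t, ht.trans T.lt_succ_self, hinv, fun u hu hu' => ?_⟩
      rcases Nat.lt_succ_iff_lt_or_eq.1 hu' with hlt | rfl
      · exact hfirst u hu hlt
      · exact hret
    · rw [pending_next_of_env_eq_some henv] at h
      exact ⟨T, T.lt_succ_self, henv.trans h, fun u hu hu' => by omega⟩

/-- The first `T` rounds of `r` are the beginning of an execution of `I` in which all operations
complete. -/
structure QuietPrefix (I : Implementation n X D A L) (r : Run n X D A L) (T : ℕ) : Prop
    extends IsPath I r T where
  init : IsInitial I (r.state 0)
  quiet : Quiet r T

theorem QuietPrefix.pending_eq_none (hr : QuietPrefix I r T) (k : Fin n) :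
    pending ((r.state T).loc k) = none := by
  by_contra h
  obtain ⟨o, ho⟩ := Option.ne_none_iff_exists'.1 h
  obtain ⟨t, ht, hinv, hfirst⟩ := hr.exists_invoked_of_pending hr.init ho
  obtain ⟨e, p, ⟨u, rfl, htu, hret, -⟩, hle⟩ := hr.quiet k t o ht hinv
  exact hfirst u htu hle p hret

end

/-! ### Fair scheduling -/

instance : Countable (Agent n) :=
  Function.Injective.countable (β := Fin n ⊕ Fin n)
    (f := fun c => match c with | .proc i => .inl i | .disp i => .inr i) <| by
      rintro (i | i) (j | j) h <;> simp_all

/-- The agent can perform a non-null action in `g`. -/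
def Agent.CanMove (I : Implementation n X D A L) (g : Global n X D A L) : Agent n → Prop
  | .proc k => TSO.CanMove I g k
  | .disp k => g.tso.buf k ≠ []

/-- Fair scheduling of an agent: if from some time on it can always move, then it does. -/
def FairTo (I : Implementation n X D A L) (r : Run n X D A L) (c : Agent n) : Prop :=
  ∀ T, (∀ t, T ≤ t → c.CanMove I (r.state t)) → ∃ t, T ≤ t ∧ (r.act t).Moves c

theorem FairTo.of_drop {I : Implementation n X D A L} {r : Run n X D A L} {c : Agent n} {T : ℕ}
    (h : FairTo I (r.drop T) c) : FairTo I r c := by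
  intro T' hT'
  obtain ⟨t, ht, hmove⟩ := h T' fun t ht => hT' (T + t) (by omega)
  exact ⟨T + t, by omega, hmove⟩

section

variable [DecidableEq X] {I : Implementation n X D A L} {r : Run n X D A L}

theorem FairTo.fairDisp {k : Fin n} (h : FairTo I r (.disp k))
    (hstep : ∀ t, r.state (t + 1) = next (r.state t) (r.act t)) : FairDisp r k := by
  intro T hT
  by_contra! hnever
  have hbuf : ∀ t, T ≤ t → (r.state t).tso.buf k ≠ [] := by
    intro t ht
    induction t, ht using Nat.le_induction with
    | base => exact hT
    | succ t ht ih =>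
      rw [hstep]
      exact next_buf_ne_nil ih (by simpa using hnever t ht)
  obtain ⟨t, ht, hmove⟩ := h T hbuf
  exact hnever t ht hmove

theorem exists_isRound_of_agent (I : Implementation n X D A L) (g : Global n X D A L)
    (b : Option (Agent n)) :
    ∃ a, IsRound I g a ∧ (∀ i, a.env i = none) ∧ (∀ c, a.Moves c → b = some c) ∧
      ∀ c, b = some c → c.CanMove I g → a.Moves c := by
  by_cases hb : ∃ c, b = some c ∧ c.CanMove I g
  · obtain ⟨c | c, rfl, hc⟩ := hb
    · obtain ⟨a, hperm, hnull, hen⟩ := hc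
      refine ⟨.single c a, isRound_single hen fun _ => hperm, fun _ => rfl,
        fun c' hc' => (Joint.eq_of_moves_single hc').symm ▸ rfl, ?_⟩
      rintro _ ⟨⟩ -
      simpa [Joint.Moves, Joint.single] using hnull
    · refine ⟨.propagate c, isRound_propagate hc, fun _ => rfl,
        fun c' hc' => (Joint.eq_of_moves_propagate hc').symm ▸ rfl, ?_⟩
      rintro _ ⟨⟩ -
      simp [Joint.Moves, Joint.propagate]
  · exact ⟨.idle, isRound_idle I g, fun _ => rfl,
      fun c hc => absurd hc (Joint.not_moves_idle c), fun c hbc hc => absurd ⟨c, hbc, hc⟩ hb⟩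

/-- The run from `g` whose round at time `t` is chosen by `c`, from `t` and the state reached. -/
def Run.generate (g : Global n X D A L) (c : ℕ → Global n X D A L → Joint n X D A L) :
    Run n X D A L :=
  let state : ℕ → Global n X D A L := Nat.rec g fun t g' => next g' (c t g')
  { state := state, act := fun t => c t (state t) }

theorem exists_fair_run_of_agents (I : Implementation n X D A L) (g : Global n X D A L)
    (S : Set (Agent n)) :
    ∃ q, q.state 0 = g ∧ (∀ M, IsPath I q M) ∧ (∀ t i, (q.act t).env i = none) ∧
      (∀ t c, (q.act t).Moves c → c ∈ S) ∧ ∀ c ∈ S, FairTo I q c := by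
  choose round hround henv honly hmoves using exists_isRound_of_agent I
  obtain ⟨f, hf⟩ := exists_surjective_nat (Option S)
  let scheduled (t : ℕ) : Option (Agent n) := (f t.unpair.1).map Subtype.val
  let q := Run.generate g fun t g' => round g' (scheduled t)
  refine ⟨q, rfl, fun M => isPath_of_env_eq_none (fun _ _ => hround _ _) (fun _ _ => rfl)
    fun _ _ => henv _ _, fun _ => henv _ _, fun t c hc => ?_, fun c hc T hT => ?_⟩
  · obtain ⟨c', -, rfl⟩ := Option.map_eq_some_iff.1 (honly _ _ c hc)
    exact c'.2
  · obtain ⟨u, hu⟩ := hf (some ⟨c, hc⟩)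
    have hle := Nat.right_le_pair u T
    exact ⟨Nat.pair u T, hle, hmoves _ _ c (by simp [scheduled, hu]) (hT _ hle)⟩

theorem IsPath.exists_fair_completion {T : ℕ} (hr : IsPath I r T)
    (hinit : IsInitial I (r.state 0)) :
    ∃ r', IsExecution I r' ∧ IsFair I r' ∧ (∀ t ≤ T, r'.state t = r.state t) ∧
      (∀ t < T, r'.act t = r.act t) ∧ ∀ t, T ≤ t → ∀ i, (r'.act t).env i = none := by
  obtain ⟨q, h0, hpath, henv, -, hfair⟩ := exists_fair_run_of_agents I (r.state T) .univ
  have hstate (t : ℕ) (ht : t ≤ T) : (r.splice T q).state t = r.state t :=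
    Run.splice_state_of_le h0 ht
  have hexec : IsExecution I (r.splice T q) := by
    refine isExecution_of_isPath (by rwa [hstate 0 T.zero_le]) fun M => ?_
    refine (hr.append (hpath M) h0 ?_).mono (Nat.le_add_left M T)
    rw [Run.written_eq_empty fun t _ => henv t]
    exact Set.disjoint_empty _
  have hfair' (c : Agent n) : FairTo I (r.splice T q) c :=
    .of_drop (T := T) (by rw [Run.drop_splice]; exact hfair c trivial)
  refine ⟨_, hexec, fun k => ⟨hfair' (.proc k), (hfair' (.disp k)).fairDisp hexec.step⟩, hstate,
    fun t ht => Run.splice_act_of_lt ht, fun t ht i => ?_⟩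
  obtain ⟨u, rfl⟩ := Nat.exists_eq_add_of_le ht
  rw [Run.splice_act_add]
  exact henv u i

end

/-! ### Operations run one after the other -/

/-- The values written by an operation. -/
def Op.written : Op A → Set A
  | .read => ∅
  | .write v => {v}

theorem Resp.Fits.exists_eq_value {p : Resp A} (h : p.Fits .read) : ∃ v, p = .value v := by
  cases p with
  | value v => exact ⟨v, rfl⟩
  | ack => exact h.elim

theorem Resp.Fits.eq_ack {p : Resp A} {v : A} (h : p.Fits (.write v)) : p = .ack := by
  cases p with
  | value => exact h.elim
  | ack => rfl

/-- The run from `g` in which, after an idle round, `o` is invoked at `k` and `w` follows. The idle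
round separates `o` from an operation that ends in `g`, as required by `Precedes`. -/
def Run.called (w : Run n X D A L) (k : Fin n) (o : Op A) (g : Global n X D A L) :
    Run n X D A L where
  state
    | 0 => g
    | 1 => g
    | t + 2 => w.state t
  act
    | 0 => .idle
    | 1 => .invoke k o
    | t + 2 => w.act t

section

theorem Run.drop_splice_called (r w : Run n X D A L) (T : ℕ) (k : Fin n) (o : Op A)
    (g : Global n X D A L) : (r.splice T (w.called k o g)).drop (T + 2) = w := by
  simp only [Run.drop, add_assoc, Run.splice_act_add, Run.splice_state_add, Nat.add_comm 2]
  rfl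

variable {w : Run n X D A L} {k : Fin n} {o : Op A} {g : Global n X D A L} {M : ℕ}

theorem quiet_of_env_eq_none (hw : ∀ t < M, ∀ i, (w.act t).env i = none) : Quiet w M :=
  fun i t o ht hi => by simp [Invoked, hw t ht i] at hi

theorem invoked_called_iff (hw : ∀ t < M, ∀ i, (w.act t).env i = none) {t : ℕ} (ht : t < M + 2)
    (i : Fin n) (o' : Op A) :
    Invoked (w.called k o g) (i, t) o' ↔ (i, t) = (k, 1) ∧ o' = o := by
  match t with
  | 0 => simp [Invoked, Run.called, Joint.idle]
  | 1 =>
    by_cases hik : i = k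
    · subst hik; simp [Invoked, Run.called, Joint.invoke, eq_comm]
    · simp [Invoked, Run.called, Joint.invoke, hik]
  | t + 2 => simp [Invoked, Run.called, hw t (by omega) i]

theorem written_called_subset (hw : ∀ t < M, ∀ i, (w.act t).env i = none) :
    (w.called k o g).written (M + 2) ⊆ o.written := by
  rintro v ⟨t, ht, i, hi⟩
  rw [← ((invoked_called_iff hw ht i _).1 hi).2]
  rfl

end

section

variable [DecidableEq X] {I : Implementation n X D A L} {r q w : Run n X D A L}
  {g g' : Global n X D A L} {k : Fin n} {o : Op A} {p : Resp A} {T M m : ℕ}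

/-- In its first `m + 1` rounds, `w` is what follows the invocation of an operation of `k` that
runs solo and in isolation, up to the return of this operation with response `p`. -/
structure IsSoloOp (I : Implementation n X D A L) (w : Run n X D A L) (k : Fin n) (p : Resp A)
    (m : ℕ) : Prop extends IsPath I w (m + 1) where
  soloBy : ∀ t < m + 1, (w.act t).SoloBy k
  env : ∀ t < m + 1, ∀ i, (w.act t).env i = none
  ret : (w.act m).proc k = .ret p
  not_ret : ∀ t < m, ∀ p', (w.act t).proc k ≠ .ret p'

/-- In its first `M` rounds, `q` consists of an operation `o` of `k` that is invoked in the second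
round and returns `p` in the last. -/
structure IsOpSegment (I : Implementation n X D A L) (q : Run n X D A L) (k : Fin n) (o : Op A)
    (p : Resp A) (M : ℕ) : Prop extends IsPath I q M where
  invoked_iff : ∀ t < M, ∀ i o', Invoked q (i, t) o' ↔ (i, t) = (k, 1) ∧ o' = o
  endsAt : EndsAt q (k, 1) M p

theorem IsSoloOp.pending (hw : IsSoloOp I w k p m) (ho : pending ((w.state 0).loc k) = some o) :
    pending ((w.state m).loc k) = some o := by
  have hpend (t : ℕ) (ht : t ≤ m) : TSO.pending ((w.state t).loc k) = some o := by
    induction t with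
    | zero => exact ho
    | succ t ih =>
      rw [hw.step t (by omega), pending_next_of_ne_ret (hw.env t (by omega) k)
        (hw.not_ret t ht), ih (by omega)]
  exact hpend m le_rfl

theorem IsSoloOp.fits (hw : IsSoloOp I w k p m) (ho : TSO.pending ((w.state 0).loc k) = some o) :
    p.Fits o := by
  have hen := (hw.round m m.lt_succ_self).enabled.proc k
  rw [hw.ret] at hen
  obtain ⟨o', ho', hfits⟩ := hen
  rw [hw.pending ho, Option.some.injEq] at ho'
  exact ho' ▸ hfits

theorem IsPath.called (hw : IsPath I w M) (henv : ∀ t < M, ∀ i, (w.act t).env i = none)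
    (h0 : w.state 0 = g.invoke k o) (hg : TSO.pending (g.loc k) = none) :
    IsPath I (w.called k o g) (M + 2) where
  round t ht := by
    match t with
    | 0 => exact isRound_idle I g
    | 1 => exact isRound_invoke hg o
    | t + 2 => exact hw.round t (by omega)
  step t ht := by
    match t with
    | 0 => exact (next_idle g).symm
    | 1 => exact h0.trans (next_invoke g k o).symm
    | t + 2 => exact hw.step t (by omega)
  write_once v t t' i i' ht ht' h h' := by
    rw [invoked_called_iff henv ht] at h
    rw [invoked_called_iff henv ht'] at h'
    exact (Prod.mk.inj (h.1.trans h'.1.symm)).symm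

theorem IsSoloOp.isOpSegment (hw : IsSoloOp I w k p m) (h0 : w.state 0 = g.invoke k o)
    (hg : TSO.pending (g.loc k) = none) : IsOpSegment I (w.called k o g) k o p (m + 3) where
  toIsPath := hw.toIsPath.called hw.env h0 hg
  invoked_iff t ht := invoked_called_iff hw.env ht
  endsAt := by
    refine ⟨m + 2, rfl, by dsimp only; omega, hw.ret, fun u hu hum p' => ?_⟩
    obtain ⟨t, rfl⟩ := Nat.exists_eq_add_of_le' (show 2 ≤ u from hu)
    exact hw.not_ret t (by omega) p'

theorem IsOpSegment.written_subset (hq : IsOpSegment I q k o p M) : q.written M ⊆ o.written := by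
  rintro v ⟨t, ht, i, hi⟩
  rw [← ((hq.invoked_iff t ht i _).1 hi).2]
  rfl

theorem IsOpSegment.invoked (hq : IsOpSegment I q k o p M) : Invoked q (k, 1) o :=
  (hq.invoked_iff 1 (one_lt_two.trans hq.endsAt.lt) k o).2 ⟨rfl, rfl⟩

theorem IsOpSegment.invoked_splice (hq : IsOpSegment I q k o p M) {t : ℕ} (ht : t < T + M)
    {i : Fin n} {o' : Op A} (h : Invoked (r.splice T q) (i, t) o') :
    t < T ∧ Invoked r (i, t) o' ∨ (i, t) = (k, T + 1) := by
  rcases lt_or_ge t T with htT | htT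
  · exact .inl ⟨htT, (Run.invoked_splice_of_lt htT).1 h⟩
  · obtain ⟨u, rfl⟩ := Nat.exists_eq_add_of_le htT
    obtain ⟨rfl, rfl⟩ := Prod.mk.inj
      ((hq.invoked_iff u (by omega) i o').1 (Run.invoked_splice_add.1 h)).1
    exact .inr rfl

theorem IsOpSegment.quiet (hq : IsOpSegment I q k o p M) : Quiet q M := fun i t o' ht hi =>
  ⟨M, p, ((hq.invoked_iff t ht i o').1 hi).1 ▸ hq.endsAt, le_rfl⟩

theorem QuietPrefix.append (hr : QuietPrefix I r T) (hq : IsPath I q M) (hquiet : Quiet q M)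
    (h0 : q.state 0 = r.state T) (hdisj : Disjoint (r.written T) (q.written M)) :
    QuietPrefix I (r.splice T q) (T + M) where
  toIsPath := hr.toIsPath.append hq h0 hdisj
  init := by
    rw [Run.splice_state_of_le h0 T.zero_le]
    exact hr.init
  quiet i t o ht hi := by
    rcases lt_or_ge t T with htT | htT
    · obtain ⟨e, p, hend, he⟩ := hr.quiet i t o htT ((Run.invoked_splice_of_lt htT).1 hi)
      exact ⟨e, p, hend.congr fun u hu => Run.splice_act_of_lt (by omega), by omega⟩
    · obtain ⟨u, rfl⟩ := Nat.exists_eq_add_of_le htT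
      obtain ⟨e, p, hend, he⟩ := hquiet i u o (by omega) (Run.invoked_splice_add.1 hi)
      exact ⟨T + e, p, hend.splice_add r T, by omega⟩

theorem QuietPrefix.append_op (hr : QuietPrefix I r T) (hq : IsOpSegment I q k o p M)
    (h0 : q.state 0 = r.state T) (hnew : Disjoint (r.written T) o.written) :
    QuietPrefix I (r.splice T q) (T + M) :=
  hr.append hq.toIsPath hq.quiet h0 (hnew.mono_right hq.written_subset)

/-- The state `g` is reached by an execution in which all operations have completed and no values
outside `S` have been written. -/
def QuietReachable (I : Implementation n X D A L) (S : Set A) (g : Global n X D A L) : Prop :=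
  ∃ r T, QuietPrefix I r T ∧ r.written T ⊆ S ∧ r.state T = g

/-- From `g`, process `k` can perform `o` with response `p` in isolation so as to reach `g'`. -/
def Performs (I : Implementation n X D A L) (k : Fin n) (o : Op A) (p : Resp A)
    (g g' : Global n X D A L) : Prop :=
  ∃ q M, q.state 0 = g ∧ IsOpSegment I q k o p M ∧ q.state M = g'

theorem QuietReachable.pending_eq_none {S : Set A} (h : QuietReachable I S g) (k : Fin n) :
    TSO.pending (g.loc k) = none := by
  obtain ⟨r, T, hr, -, rfl⟩ := h
  exact hr.pending_eq_none k

theorem QuietReachable.next {S : Set A} (hg : QuietReachable I S g) {a : Joint n X D A L}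
    (ha : IsRound I g a) (henv : ∀ i, a.env i = none) : QuietReachable I S (next g a) := by
  obtain ⟨r, T, hr, hS, rfl⟩ := hg
  let q : Run n X D A L := .generate (r.state T) fun _ _ => a
  have hq : IsPath I q 1 := by
    refine isPath_of_env_eq_none (fun t ht => ?_) (fun _ _ => rfl) fun _ _ => henv
    obtain rfl : t = 0 := by omega
    exact ha
  have hwritten : q.written 1 = ∅ := Run.written_eq_empty fun _ _ => henv
  refine ⟨r.splice T q, T + 1, hr.append hq (quiet_of_env_eq_none fun _ _ => henv) rfl
    (hwritten ▸ Set.disjoint_empty _), ?_, Run.splice_state_add r q T 1⟩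
  refine (Run.written_splice_subset r q T 1).trans (Set.union_subset hS ?_)
  rw [hwritten]
  exact Set.empty_subset S

theorem QuietReachable.performs {S : Set A} (h : QuietReachable I S g)
    (hop : Performs I k o p g g') (hnew : Disjoint S o.written) :
    QuietReachable I (S ∪ o.written) g' := by
  obtain ⟨r, T, hr, hS, rfl⟩ := h
  obtain ⟨q, M, h0, hq, rfl⟩ := hop
  refine ⟨r.splice T q, T + M, hr.append_op hq h0 (hnew.mono_left hS),
    (Run.written_splice_subset r q T M).trans (Set.union_subset_union hS hq.written_subset),
    Run.splice_state_add r q T M⟩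

theorem IsSoloOp.performs (hw : IsSoloOp I w k p m) (h0 : w.state 0 = g.invoke k o)
    (hg : TSO.pending (g.loc k) = none) : Performs I k o p g (w.state (m + 1)) :=
  ⟨w.called k o g, m + 3, rfl, hw.isOpSegment h0 hg, rfl⟩

end

/-! ### Reads after writes -/

theorem value_eq_of_linearizableRun {v₀ : A} {r : Run n X D A L} (hlin : LinearizableRun v₀ r)
    {α β : Fin n × ℕ} {w v : A} {e e' : ℕ} {p : Resp A} (hα : Invoked r α (.write w))
    (hαe : EndsAt r α e p) (hβ : Invoked r β .read) (hβe : EndsAt r β e' (.value v))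
    (hαβ : Precedes r α β)
    (hother : ∀ γ o, Invoked r γ o → γ ≠ α → γ ≠ β → Precedes r γ α) : v = w := by
  obtain ⟨C, pos, -, hcompleted, -, hpos, hread⟩ := hlin
  have hαC := hcompleted α _ _ _ hα hαe
  have hlt := hpos α hαC β (hcompleted β _ _ _ hβ hβe) hαβ
  obtain ⟨γ, hγC, hγ, hγβ, hlast⟩ | ⟨-, hnone⟩ := hread β e' v hβ hβe
  · suffices hγα : γ = α by
      subst hγα
      exact Op.write.inj (Option.some.inj (hγ.symm.trans hα))
    by_contra hγα
    have hγlt := hpos γ hγC α hαC (hother γ _ hγ hγα fun h => hγβ.ne (h ▸ rfl))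
    exact (hlast α hαC w hα hlt).not_gt hγlt
  · exact absurd hlt (hnone α hαC w hα)

section

variable [DecidableEq X] {I : Implementation n X D A L}

theorem QuietPrefix.exists_fair_run {r q : Run n X D A L} {T M : ℕ} {k : Fin n} {o : Op A}
    {p : Resp A} (hr : QuietPrefix I r T) (hq : IsOpSegment I q k o p M)
    (h0 : q.state 0 = r.state T) (hnew : Disjoint (r.written T) o.written) :
    ∃ R, IsExecution I R ∧ IsFair I R ∧ (∀ t ≤ T, R.state t = r.state t) ∧
      (∀ t < T + M, R.act t = (r.splice T q).act t) ∧
      (∀ t, T + M ≤ t → ∀ i, (R.act t).env i = none) ∧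
      Invoked R (k, T + 1) o ∧ EndsAt R (k, T + 1) (T + M) p := by
  have hr' := hr.append_op hq h0 hnew
  obtain ⟨R, hexec, hfair, hstate, hact, henv⟩ := hr'.toIsPath.exists_fair_completion hr'.init
  have hM : 1 + 1 < M := hq.endsAt.lt
  refine ⟨R, hexec, hfair, fun t ht => ?_, hact, henv, ?_, (hq.endsAt.splice_add r T).congr hact⟩
  · rw [hstate t (by omega), Run.splice_state_of_le h0 ht]
  · rw [Invoked, hact (T + 1) (by omega)]
    exact Run.invoked_splice_add.2 hq.invoked

theorem QuietPrefix.value_eq {v₀ : A} (hLin : Linearizable I v₀) {r q q' : Run n X D A L}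
    {T M M' : ℕ} {k k' : Fin n} {w v : A} {p : Resp A} (hr : QuietPrefix I r T)
    (hw : w ∉ r.written T) (hq : IsOpSegment I q k (.write w) p M) (hq0 : q.state 0 = r.state T)
    (hq' : IsOpSegment I q' k' .read (.value v) M') (hq0' : q'.state 0 = q.state M) : v = w := by
  have hr₁ := hr.append_op hq hq0 (Set.disjoint_singleton_right.2 hw)
  obtain ⟨R, hexec, hfair, -, hact₂, henv, hread, hread_end⟩ := hr₁.exists_fair_run hq'
    (hq0'.trans (Run.splice_state_add r q T M).symm) (Set.disjoint_empty _)
  have hact₁ (t : ℕ) (ht : t < T + M) : R.act t = (r.splice T q).act t := by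
    rw [hact₂ t (by omega), Run.splice_act_of_lt ht]
  have hM : 1 + 1 < M := hq.endsAt.lt
  have hwrite : Invoked R (k, T + 1) (.write w) := by
    rw [Invoked, hact₁ (T + 1) (by omega)]
    exact Run.invoked_splice_add.2 hq.invoked
  have hwrite_end : EndsAt R (k, T + 1) (T + M) p := (hq.endsAt.splice_add r T).congr hact₁
  refine value_eq_of_linearizableRun (hLin R hexec hfair) hwrite hwrite_end hread hread_end
    ⟨_, _, hwrite_end, Nat.lt_succ_self _⟩ ?_
  rintro ⟨i, t⟩ o hi hne_write hne_read
  have ht : t < T + M + M' := by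
    by_contra ht
    simp [Invoked, henv t (not_lt.1 ht)] at hi
  rw [Invoked, hact₂ t ht] at hi
  obtain ⟨ht, hi⟩ := (hq'.invoked_splice ht hi).resolve_right hne_read
  obtain ⟨ht, hi⟩ := (hq.invoked_splice ht hi).resolve_right hne_write
  obtain ⟨e, p', hend, he⟩ := hr.quiet i t o ht hi
  refine ⟨e, p', hend.congr fun u hu => ?_, Nat.lt_succ_of_le he⟩
  rw [hact₁ u (by omega), Run.splice_act_of_lt (by omega)]

theorem QuietReachable.value_eq {v₀ : A} (hLin : Linearizable I v₀) {S : Set A}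
    {g g₁ g₂ : Global n X D A L} {k k' : Fin n} {w v : A} {p : Resp A}
    (hg : QuietReachable I S g) (hw : w ∉ S) (hwrite : Performs I k (.write w) p g g₁)
    (hread : Performs I k' .read (.value v) g₁ g₂) : v = w := by
  obtain ⟨r, T, hr, hS, rfl⟩ := hg
  obtain ⟨q, M, hq0, hq, rfl⟩ := hwrite
  obtain ⟨q', M', hq0', hq', -⟩ := hread
  exact hr.value_eq hLin (fun h => hw (hS h)) hq hq0 hq' hq0'

theorem QuietReachable.exists_ret (hOF : ObstructionFree I) {S : Set A} {g : Global n X D A L}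
    (hg : QuietReachable I S g) {k : Fin n} {o : Op A} (hnew : Disjoint S o.written)
    {q : Run n X D A L} (h0 : q.state 0 = g.invoke k o) (hpath : ∀ M, IsPath I q M)
    (hsolo : ∀ t, (q.act t).SoloBy k) (henv : ∀ t i, (q.act t).env i = none)
    (hproc : FairTo I q (.proc k)) (hdisp : FairTo I q (.disp k)) :
    ∃ t p, (q.act t).proc k = .ret p := by
  have hpending := hg.pending_eq_none k
  obtain ⟨r, T, hr, hS, rfl⟩ := hg
  obtain ⟨R, hR⟩ : ∃ R, R = r.splice T (q.called k o (r.state T)) := ⟨_, rfl⟩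
  have hdrop : R.drop (T + 2) = q := by rw [hR, Run.drop_splice_called]
  have hact (t : ℕ) : R.act (T + 2 + t) = q.act t := congrArg (Run.act · t) hdrop
  have hexec : IsExecution I R := by
    refine isExecution_of_isPath ?_ fun M => ?_
    · rw [hR, Run.splice_state_of_le (T := T) rfl T.zero_le]
      exact hr.init
    · have hcalled := (hpath M).called (fun t _ => henv t) h0 hpending
      rw [hR]
      refine (hr.toIsPath.append hcalled rfl ?_).mono (by omega : M ≤ T + (M + 2))
      exact hnew.mono hS (written_called_subset fun t _ => henv t)
  have hproc' : FairTo I R (.proc k) := .of_drop (T := T + 2) (hdrop ▸ hproc)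
  have hdisp' : FairTo I R (.disp k) := .of_drop (T := T + 2) (hdrop ▸ hdisp)
  have hsolo' (e : ℕ) : Solo R k (T + 2) e := fun t ht _ => by
    obtain ⟨u, rfl⟩ := Nat.exists_eq_add_of_le ht
    exact hact u ▸ hsolo u
  have hcalled : pending ((R.state (T + 2)).loc k) ≠ none := by
    rw [show R.state (T + 2) = q.state 0 from congrArg (Run.state · 0) hdrop, h0,
      Global.pending_invoke]
    exact Option.some_ne_none o
  obtain ⟨t, p, ht, hret⟩ :=
    hOF R hexec k (T + 2) hcalled hsolo' hproc' (hdisp'.fairDisp hexec.step)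
  obtain ⟨u, rfl⟩ := Nat.exists_eq_add_of_le ht
  exact ⟨u, p, hact u ▸ hret⟩

theorem QuietReachable.exists_isSoloOp (hOF : ObstructionFree I) {S : Set A}
    {g : Global n X D A L} (hg : QuietReachable I S g) (k : Fin n) {o : Op A}
    (hnew : Disjoint S o.written) :
    ∃ w p m, w.state 0 = g.invoke k o ∧ IsSoloOp I w k p m := by
  classical
  obtain ⟨q, h0, hpath, henv, honly, hfair⟩ :=
    exists_fair_run_of_agents I (g.invoke k o) {.proc k, .disp k}
  have hsolo (t : ℕ) : (q.act t).SoloBy k := Joint.soloBy_of_forall_moves (honly t)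
  have hret := hg.exists_ret hOF hnew h0 hpath hsolo henv (hfair _ (.inl rfl)) (hfair _ (.inr rfl))
  obtain ⟨p, hp⟩ := Nat.find_spec hret
  exact ⟨q, p, Nat.find hret, h0, hpath _, fun t _ => hsolo t, fun t _ => henv t, hp,
    fun t ht p' h => Nat.find_min hret ht ⟨p', h⟩⟩

end

/-! ### Replaying an operation without propagations -/

/-- Process `k` performs no fence and no read-modify-write in the first `M` rounds. -/
def Run.SyncFree (w : Run n X D A L) (k : Fin n) (M : ℕ) : Prop :=
  ∀ t < M, ¬ ((w.act t).proc k).IsSync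

section

variable [DecidableEq X]

/-- The run from `g` in which `k` acts as in `w` and nothing else happens. -/
def Run.replay (w : Run n X D A L) (k : Fin n) (g : Global n X D A L) : Run n X D A L :=
  .generate g fun t _ => .single k ((w.act t).proc k)

variable {I : Implementation n X D A L} {w : Run n X D A L} {g g' : Global n X D A L}
  {k : Fin n} {o : Op A} {p : Resp A} {m M : ℕ}

theorem Run.replay_act_proc (w : Run n X D A L) (k : Fin n) (g : Global n X D A L) (t : ℕ) :
    ((w.replay k g).act t).proc k = (w.act t).proc k := by
  simp [Run.replay, Run.generate, Joint.single]

theorem SameView.actEnabled (h : SameView k g g') {a : Act X D A L} (ha : ¬ a.IsSync)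
    (hen : ActEnabled g k a) : ActEnabled g' k a := by
  cases a with
  | fence => exact absurd trivial ha
  | rmw => exact absurd trivial ha
  | ret p =>
    rw [ActEnabled, ← h.2]
    exact hen
  | _ => trivial

theorem IsSoloOp.sameView_replay (hw : IsSoloOp I w k p m) (hsync : w.SyncFree k (m + 1))
    (h0 : SameView k (w.state 0) g) {t : ℕ} (ht : t ≤ m + 1) :
    SameView k (w.state t) ((w.replay k g).state t) := by
  induction t with
  | zero => exact h0
  | succ t ih =>
    rw [hw.step t ht]
    exact (ih (by omega)).next (hw.soloBy t ht) (Joint.soloBy_single k _) (hsync t ht)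
      (w.replay_act_proc k g t) (hw.env t ht k).symm

theorem IsSoloOp.replay (hw : IsSoloOp I w k p m) (hsync : w.SyncFree k (m + 1))
    (h0 : SameView k (w.state 0) g) : IsSoloOp I (w.replay k g) k p m where
  toIsPath := by
    refine isPath_of_env_eq_none (fun t ht => ?_) (fun _ _ => rfl) fun _ _ _ => rfl
    have hview := hw.sameView_replay hsync h0 ht.le
    have hround := hw.round t ht
    exact isRound_single (hview.actEnabled (hsync t ht) (hround.enabled.proc k))
      fun hmove => hview.2 ▸ hround.follows k hmove
  soloBy _ _ := Joint.soloBy_single k _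
  env _ _ _ := rfl
  ret := (w.replay_act_proc k g m).trans hw.ret
  not_ret t ht p' := by
    rw [Run.replay_act_proc]
    exact hw.not_ret t ht p'

theorem Run.SyncFree.exists_replay_state_eq (hsync : w.SyncFree k M) :
    ∃ β, ∀ g, (w.replay k g).state M = g.buffered k β (((w.replay k g).state M).loc k) := by
  induction M with
  | zero =>
    refine ⟨[], fun g => ?_⟩
    simp [Global.buffered, Run.replay, Run.generate]
  | succ M ih =>
    obtain ⟨β, hβ⟩ := ih fun t ht => hsync t (by omega)
    obtain ⟨γ, hγ⟩ := exists_actEffect_eq_append k (hsync M M.lt_succ_self)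
    refine ⟨β ++ γ, fun g => ?_⟩
    rw [show (w.replay k g).state (M + 1) = next ((w.replay k g).state M) (.single k _) from rfl,
      next_single, hγ, hβ g]
    simp [Global.buffered]

theorem Run.SyncFree.sameView_replay {j : Fin n} (hsync : w.SyncFree k M) (hj : j ≠ k)
    (g : Global n X D A L) : SameView j g ((w.replay k g).state M) := by
  obtain ⟨β, hβ⟩ := hsync.exists_replay_state_eq
  exact hβ g ▸ sameView_buffered hj g β _

theorem IsSoloOp.exists_replay_state_eq (hw : IsSoloOp I w k p m)
    (hsync : w.SyncFree k (m + 1)) :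
    ∃ β l, ∀ g, SameView k (w.state 0) g →
      (w.replay k g).state (m + 1) = g.buffered k β l := by
  obtain ⟨β, hβ⟩ := hsync.exists_replay_state_eq
  refine ⟨β, (w.state (m + 1)).loc k, fun g hg => ?_⟩
  rw [hβ g, (hw.sameView_replay hsync hg le_rfl).2]

theorem IsSoloOp.exists_performs (hw : IsSoloOp I w k p m) (hsync : w.SyncFree k (m + 1))
    (h0 : SameView k (w.state 0) (g.invoke k o)) (hg : TSO.pending (g.loc k) = none) :
    ∃ β l, ∀ g', SameView k g g' → Performs I k o p g' (g'.buffered k β l) := by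
  obtain ⟨β, l, hstate⟩ := hw.exists_replay_state_eq hsync
  refine ⟨β, l, fun g' hview => ?_⟩
  have h0' := h0.trans (hview.invoke o)
  have hperforms := (hw.replay hsync h0').performs rfl (hview.2 ▸ hg)
  rwa [hstate _ h0', Global.buffered_invoke] at hperforms

end

/-! ### Operations that do not commute -/

section

variable [DecidableEq X] {I : Implementation n X D A L} {g gX gB g' : Global n X D A L}
  {i j : Fin n} {o : Op A} {p p' : Resp A} {a b v₀ : A} {S : Set A} {m m' : ℕ}

theorem QuietReachable.not_performs_comm (hOF : ObstructionFree I)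
    (hLin : Linearizable I v₀) (hg : QuietReachable I S g) (hval : IsValueOp a o p)
    (hab : b ≠ a) (ho : Disjoint S o.written) (hb : b ∉ S)
    (hX : Performs I i o p g gX) (hXB : Performs I j (.write b) p' gX g')
    (hB : Performs I j (.write b) p' g gB) : ¬ Performs I i o p gB g' := by
  intro hBX
  rcases hval with ⟨rfl, rfl⟩ | ⟨rfl, rfl⟩
  · exact hab (hg.value_eq hLin hb hB hBX).symm
  have ha : a ∉ S := Set.disjoint_singleton_right.1 ho
  have hgX := hg.performs hX ho
  have hgB := hg.performs hB (Set.disjoint_singleton_right.2 hb)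
  have hbX : b ∉ S ∪ {a} := by simp [hb, hab]
  have haB : a ∉ S ∪ {b} := by simp [ha, hab.symm]
  have hg' := hgX.performs hXB (Set.disjoint_singleton_right.2 hbX)
  obtain ⟨w, pR, mR, hw0, hw⟩ :=
    hg'.exists_isSoloOp (o := .read) hOF j (Set.disjoint_empty _)
  obtain ⟨v, rfl⟩ := (hw.fits (hw0 ▸ g'.pending_invoke j .read)).exists_eq_value
  have hread := hw.performs hw0 (hg'.pending_eq_none j)
  have hvb : v = b := hgX.value_eq hLin hbX hXB hread
  have hva : v = a := hgB.value_eq hLin haB hBX hread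
  exact hab (hvb.symm.trans hva)

theorem QuietReachable.not_syncFree (hOF : ObstructionFree I)
    (hLin : Linearizable I v₀) (hg : QuietReachable I S g) (hij : j ≠ i)
    (hval : IsValueOp a o p) (hab : b ≠ a) (ho : Disjoint S o.written) (hb : b ∉ S)
    {u w : Run n X D A L} (hu : IsSoloOp I u i p m) (hu0 : SameView i (u.state 0) (g.invoke i o))
    (hu_sync : u.SyncFree i (m + 1)) (hw : IsSoloOp I w j p' m')
    (hw0 : SameView j (w.state 0) (g.invoke j (.write b))) : ¬ w.SyncFree j (m' + 1) := by
  intro hw_sync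
  obtain ⟨β, l, hX⟩ := hu.exists_performs hu_sync hu0 (hg.pending_eq_none i)
  obtain ⟨γ, l', hB⟩ := hw.exists_performs hw_sync hw0 (hg.pending_eq_none j)
  have hBX := hX _ (sameView_buffered hij.symm g γ l')
  rw [← g.buffered_comm hij.symm] at hBX
  exact hg.not_performs_comm hOF hLin hval hab ho hb (hX g ⟨rfl, rfl⟩)
    (hB _ (sameView_buffered hij g β l)) (hB g ⟨rfl, rfl⟩) hBX

end

/-! ### Suppressing the propagations of an operation in isolation -/

theorem InIsolation.eq_of_invoked {r : Run n X D A L} {α β : Fin n × ℕ} {e : ℕ} {p : Resp A}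
    {o : Op A} (hα : InIsolation r α) (hend : EndsAt r α e p) (hβ : Invoked r β o)
    (hge : α.2 ≤ β.2) (hlt : β.2 < e) : β = α := by
  by_contra hne
  obtain ⟨e', p', hend', hlt'⟩ := hα.exists_endsAt_lt hend hβ hne hlt
  have := hend'.lt
  omega

section

variable {r : Run n X D A L} {i : Fin n} {s e : ℕ} {p : Resp A}

theorem InIsolation.quiet (hiso : InIsolation r (i, s)) (hend : EndsAt r (i, s) e p) :
    Quiet r s := by
  intro k t o ht hi
  have hs : s + 1 < e := hend.lt
  obtain ⟨e', p', hend', hlt⟩ := hiso.exists_endsAt_lt hend hi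
    (fun h => ht.ne (congrArg Prod.snd h)) (ht.trans (by omega))
  exact ⟨e', p', hend', hlt.le⟩

variable [DecidableEq X] {I : Implementation n X D A L} {w : Run n X D A L} {m : ℕ}

theorem IsExecution.exists_isSoloOp_drop (hr : IsExecution I r) (hend : EndsAt r (i, s) e p)
    (hsolo : Solo r i s e) (hiso : InIsolation r (i, s)) :
    ∃ m, e = s + 1 + (m + 1) ∧ IsSoloOp I (r.drop (s + 1)) i p m := by
  obtain ⟨t, he, hst, hret, hfirst⟩ := id hend
  obtain ⟨m, rfl⟩ := Nat.exists_eq_add_of_le (show s + 1 ≤ t from hst)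
  refine ⟨m, he, (hr.isPath _).drop, fun u hu => hsolo (s + 1 + u) (by omega) (by omega),
    fun u hu k => ?_, hret, fun u hu => hfirst (s + 1 + u) (by dsimp only; omega) (by omega)⟩
  by_contra henv
  obtain ⟨o, ho⟩ := Option.ne_none_iff_exists'.1 henv
  have := congrArg Prod.snd (hiso.eq_of_invoked hend (β := (k, s + 1 + u)) ho
    (by dsimp only; omega) (by dsimp only; omega))
  dsimp only at this
  omega

theorem IsSoloOp.endsAt_splice (hw : IsSoloOp I w i p m) (r : Run n X D A L) (s : ℕ) :
    EndsAt (r.splice (s + 1) w) (i, s) (s + 1 + (m + 1)) p := by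
  refine ⟨s + 1 + m, rfl, by dsimp only; omega, by rw [Run.splice_act_add]; exact hw.ret,
    fun t hst ht => ?_⟩
  obtain ⟨u, rfl⟩ := Nat.exists_eq_add_of_le (show s + 1 ≤ t from hst)
  rw [Run.splice_act_add]
  exact hw.not_ret u (by omega)

theorem IsExecution.quietPrefix_splice (hr : IsExecution I r) (hend : EndsAt r (i, s) e p)
    (hiso : InIsolation r (i, s)) (hw : IsSoloOp I w i p m) (h0 : w.state 0 = r.state (s + 1)) :
    QuietPrefix I (r.splice (s + 1) w) (s + 1 + (m + 1)) where
  toIsPath := (hr.isPath (s + 1)).append hw.toIsPath h0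
    (Run.written_eq_empty hw.env ▸ Set.disjoint_empty _)
  init := by
    rw [Run.splice_state_of_le h0 (Nat.zero_le _)]
    exact hr.isInitial
  quiet k t o ht hi := by
    rcases lt_or_ge t (s + 1) with hts | hts
    · rw [Run.invoked_splice_of_lt hts] at hi
      by_cases hkt : (k, t) = (i, s)
      · exact ⟨_, p, hkt ▸ hw.endsAt_splice r s, le_rfl⟩
      · have hs : s + 1 < e := hend.lt
        obtain ⟨e', p', hend', hlt⟩ :=
          hiso.exists_endsAt_lt hend hi hkt (hts.trans hs)
        dsimp only at hlt
        exact ⟨e', p', hend'.congr fun u hu => Run.splice_act_of_lt (by omega), by omega⟩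
    · obtain ⟨u, rfl⟩ := Nat.exists_eq_add_of_le hts
      rw [Run.invoked_splice_add, Invoked, hw.env u (by omega)] at hi
      cases hi

theorem IsSoloOp.written_splice_subset (hw : IsSoloOp I w i p m) (r : Run n X D A L) (T : ℕ) :
    (r.splice T w).written (T + (m + 1)) ⊆ r.written T := by
  refine (Run.written_splice_subset r w T (m + 1)).trans (Set.union_subset subset_rfl ?_)
  rw [Run.written_eq_empty hw.env]
  exact Set.empty_subset _

theorem IsSoloOp.indistUntil_splice_replay {T : ℕ} (hw : IsSoloOp I (r.drop T) i p m)
    (hsync : (r.drop T).SyncFree i (m + 1)) :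
    IndistUntil r (r.splice T ((r.drop T).replay i (r.state T))) i (T + (m + 1)) := by
  intro t ht
  rcases le_total t T with htT | htT
  · rw [Run.splice_state_of_le (T := T) rfl htT]
  · obtain ⟨u, rfl⟩ := Nat.exists_eq_add_of_le htT
    rw [Run.splice_state_add]
    exact (hw.sameView_replay hsync ⟨rfl, rfl⟩ (by omega)).2.symm

theorem IsExecution.exists_quietPrefix_replay (hr : IsExecution I r) {o : Op A}
    (hinv : Invoked r (i, s) o) (hend : EndsAt r (i, s) e p) (hiso : InIsolation r (i, s))
    (hX : IsSoloOp I (r.drop (s + 1)) i p m) (hsync : (r.drop (s + 1)).SyncFree i (m + 1)) :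
    ∃ R, QuietPrefix I R (s + 1 + (m + 1)) ∧ IndistUntil r R i (s + 1 + (m + 1)) ∧
      Invoked R (i, s) o ∧ EndsAt R (i, s) (s + 1 + (m + 1)) p ∧
      R.written (s + 1 + (m + 1)) ⊆ r.written (s + 1) ∧
      ∀ k ≠ i, SameView k (r.state (s + 1)) (R.state (s + 1 + (m + 1))) := by
  have hreplay := hX.replay (g := r.state (s + 1)) hsync ⟨rfl, rfl⟩
  refine ⟨_, hr.quietPrefix_splice hend hiso hreplay rfl, hX.indistUntil_splice_replay hsync,
    (Run.invoked_splice_of_lt s.lt_succ_self).2 hinv, hreplay.endsAt_splice r s,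
    hreplay.written_splice_subset r (s + 1), fun k hk => ?_⟩
  rw [Run.splice_state_add]
  exact hsync.sameView_replay hk _

theorem IsExecution.disjoint_written (hr : IsExecution I r) {o : Op A} (hinv : Invoked r (i, s) o) :
    Disjoint (r.written s) o.written := by
  rw [Set.disjoint_left]
  rintro v ⟨t, ht, k, hk⟩ hv
  cases o with
  | read => exact hv
  | write v' =>
    obtain rfl : v = v' := hv
    exact ht.ne (hr.write_once v t s k i hk hinv).1

theorem IsExecution.not_syncFree {v₀ : A} (hOF : ObstructionFree I) (hLin : Linearizable I v₀)
    {a b : A} (hab : b ≠ a) (hr : IsExecution I r) {o : Op A} (hinv : Invoked r (i, s) o)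
    (hend : EndsAt r (i, s) e p) (hval : IsValueOp a o p) (hiso : InIsolation r (i, s))
    (hX : IsSoloOp I (r.drop (s + 1)) i p m) (hX_sync : (r.drop (s + 1)).SyncFree i (m + 1))
    (hb : b ∉ r.written s) {j : Fin n} (hji : j ≠ i) {p' : Resp A} {m' : ℕ}
    (hw : IsSoloOp I w j p' m')
    (hw0 : SameView j (w.state 0) ((r.state (s + 1)).invoke j (.write b))) :
    ¬ w.SyncFree j (m' + 1) := by
  have hs : s + 1 < e := hend.lt
  have hpre : QuietPrefix I r s := ⟨hr.isPath s, hr.isInitial, hiso.quiet hend⟩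
  have hround := ((hr.isPath (s + 1)).round s s.lt_succ_self).withoutInvocations
  set g := next (r.state s) (r.act s).withoutInvocations
  have hg : QuietReachable I (r.written s) g :=
    QuietReachable.next ⟨r, s, hpre, le_rfl, rfl⟩ hround fun _ => rfl
  have hinvoke : r.state (s + 1) = g.invoke i o := by
    rw [hr.step s]
    refine next_eq_invoke hinv fun k hki => ?_
    by_contra henv
    obtain ⟨o', ho'⟩ := Option.ne_none_iff_exists'.1 henv
    exact hki (congrArg Prod.fst (hiso.eq_of_invoked hend (β := (k, s)) ho' le_rfl
      (by dsimp only; omega)))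
  refine hg.not_syncFree hOF hLin hji hval hab (hr.disjoint_written hinv) hb hX ?_ hX_sync hw ?_
  · exact hinvoke ▸ ⟨rfl, rfl⟩
  · rw [hinvoke] at hw0
    exact hw0.trans ((sameView_invoke hji g o).symm.invoke _)

theorem QuietPrefix.exists_fair_run_containsSync {T : ℕ} {k : Fin n} {o : Op A}
    (hr : QuietPrefix I r T) (hw : IsSoloOp I w k p m) (hw0 : w.state 0 = (r.state T).invoke k o)
    (hnew : Disjoint (r.written T) o.written) (hw_sync : ¬ w.SyncFree k (m + 1)) :
    ∃ R, IsExecution I R ∧ IsFair I R ∧ (∀ t ≤ T, R.state t = r.state t) ∧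
      (∀ t < T, R.act t = r.act t) ∧ Invoked R (k, T + 1) o ∧
      EndsAt R (k, T + 1) (T + (m + 3)) p ∧ ContainsSync R k (T + 1) (T + (m + 3)) := by
  obtain ⟨R, hexec, hfair, hstate, hact, -, hinv, hend⟩ :=
    hr.exists_fair_run (hw.isOpSegment hw0 (hr.pending_eq_none k)) rfl hnew
  simp only [Run.SyncFree, not_forall, not_not] at hw_sync
  obtain ⟨t, ht, hsync⟩ := hw_sync
  refine ⟨R, hexec, hfair, hstate, fun u hu => ?_, hinv, hend, T + (t + 2), by omega, by omega, ?_⟩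
  · rw [hact u (by omega), Run.splice_act_of_lt hu]
  · rw [hact _ (by omega), Run.splice_act_add]
    exact hsync

end
end TSO

theorem mainTheorem5 {n : ℕ} {X D A L : Type*} [DecidableEq X]
    (I : TSO.Implementation n X D A L) (v₀ : A)
    (hOF : TSO.ObstructionFree I) (hLin : TSO.Linearizable I v₀)
    (a b : A) (hab : b ≠ a)
    (r : TSO.Run n X D A L) (hr : TSO.IsExecution I r)
    (i : Fin n) (s e : ℕ) (o : TSO.Op A) (p : TSO.Resp A)
    (hinv : TSO.Invoked r (i, s) o) (hend : TSO.EndsAt r (i, s) e p)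
    (hval : TSO.IsValueOp a o p)
    (hsolo : TSO.Solo r i s e) (hiso : TSO.InIsolation r (i, s))
    (hsync : ¬ TSO.ContainsSync r i s e)
    (hfresh : ∀ t k, t < e → ¬ TSO.Invoked r (k, t) (.write b))
    (j : Fin n) (hji : j ≠ i) :
    ∃ (r' : TSO.Run n X D A L) (s' e' : ℕ),
      TSO.IsExecution I r' ∧ TSO.IsFair I r' ∧
      TSO.IndistUntil r r' i e ∧
      TSO.Invoked r' (i, s) o ∧ TSO.EndsAt r' (i, s) e p ∧
      TSO.Invoked r' (j, s') (.write b) ∧ TSO.EndsAt r' (j, s') e' .ack ∧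
      TSO.Precedes r' (i, s) (j, s') ∧
      TSO.ContainsSync r' j s' e' := by
  open TSO in
  obtain ⟨m, rfl, hX⟩ := hr.exists_isSoloOp_drop hend hsolo hiso
  have hX_sync : (r.drop (s + 1)).SyncFree i (m + 1) := fun t ht h =>
    hsync ⟨s + 1 + t, by omega, by omega, h⟩
  obtain ⟨R, hR, hindist, hinvR, hendR, hwritten, hview⟩ :=
    hr.exists_quietPrefix_replay hinv hend hiso hX hX_sync
  have hbr (t : ℕ) (ht : t ≤ s + 1 + (m + 1)) : b ∉ r.written t :=
    fun ⟨u, hu, k, hk⟩ => hfresh u k (hu.trans_le ht) hk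
  have hb : Disjoint (R.written (s + 1 + (m + 1))) (Op.write b).written :=
    Set.disjoint_singleton_right.2 fun h => hbr (s + 1) (by omega) (hwritten h)
  obtain ⟨w, pw, m', hw0, hw⟩ := QuietReachable.exists_isSoloOp hOF ⟨R, _, hR, le_rfl, rfl⟩ j hb
  obtain rfl := (hw.fits (hw0 ▸ Global.pending_invoke ..)).eq_ack
  have hw_sync := hr.not_syncFree hOF hLin hab hinv hend hval hiso hX hX_sync
    (hbr s (by omega)) hji hw (hw0 ▸ (hview j hji).symm.invoke _)
  obtain ⟨r', hexec, hfair, hstate, hact, hinv', hend', hsync'⟩ :=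
    hR.exists_fair_run_containsSync hw hw0 hb hw_sync
  have hend_r' := hendR.congr hact
  refine ⟨r', _, _, hexec, hfair, fun t ht => ?_, ?_, hend_r', hinv', hend',
    ⟨_, _, hend_r', Nat.lt_succ_self _⟩, hsync'⟩
  · rw [hstate t ht, hindist t ht]
  · rwa [Invoked, hact s (by omega)]
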